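/- Let $p$ be a prime. Suppose the radical of $p-1$ (the product of its distinct prime divisors) is written as $\mathrm{Rad}(p-1)=k\,p_1\cdots p_s$, where $p_1,\dots,p_s$ are distinct primes, $1\le s\le \omega(p-1)$, and $k$ is the product of the smallest $\omega(p-1)-s$ distinct primes dividing $p-1$; here $\omega(n)$ is the number of distinct prime divisors of $n$. Let $$\delta = 1-\sum_{i=1}^{s}\frac1{p_i},$$ suppose $\delta>0$, and let $\Delta=\dfrac{s-1}{\delta}+2$. Put $$c=\frac1{\pi\sqrt2}+\frac{6}{\pi\sqrt2\,\log p}+\frac1{\log p},\qquad A=0.679091,$$ and, for a real number $x>0$, $$D=\Bigl(\frac{x}{c\sqrt p\,\log p}\Bigr)^{1/2},\qquad \hat D=\frac{D}{D-1},$$ \begin{align*} E=(\log p)^{1/2}\Bigl(&\tfrac{6}{\pi^2}\bigl(c^{1/2}+\hat D c^{1/2}-p^{-1/4}(\log p)^{-1/2}\bigr)\\ &+A\bigl(p^{1/8}x^{-1/4}c^{3/4}(\log p)^{1/4}-\tfrac13p^{-1/4}x^{-1/4}(\log p)^{1/2}+\tfrac73p^{1/8}x^{-1/4}(\log p)^{1/4}c^{3/4}\bigr)\Bigr).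 \end{align*} If $x>c\sqrt p\,\log p$ (that is, $D>1$) and $$G_s(x):=x^{1/2}p^{-1/4}-\frac{\pi^2}{6}\Bigl(\frac{0.104}{p^{1/4}}+\bigl(2^{\omega(k)}\Delta+1\bigr)E\Bigr)>0,$$ then there is a square-free positive integer less than $x$ that is a primitive root modulo $p$. -/

import Mathlib

namespace SquarefreePrimitiveRoot

/-- `g` is a primitive root modulo `m`: it is coprime to `m` and its multiplicative order
modulo `m` equals `φ(m)`. -/
def IsPrimRootMod (g m : ℕ) : Prop :=
  Nat.Coprime g m ∧ orderOf (g : ZMod m) = Nat.totient m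

/-- The constant `c = c(p)` of the explicit Pólya–Vinogradov inequality. -/
noncomputable def pvConst (p : ℕ) : ℝ :=
  1 / (Real.pi * Real.sqrt 2) + 6 / (Real.pi * Real.sqrt 2 * Real.log p) + 1 / Real.log p

/-- Cipu's constant `A`, from `∑_{n ≤ y} |μ(n)| ≤ (6/π²) y + A √y`. -/
noncomputable def cipuConst : ℝ := 0.679091

/-- `D = (x / (c √p log p)) ^ (1/2)`. -/
noncomputable def splitD (p : ℕ) (x : ℝ) : ℝ :=
  (x / (pvConst p * Real.sqrt p * Real.log p)) ^ (1 / 2 : ℝ)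

/-- `D̂ = D / (D - 1)`. -/
noncomputable def splitDHat (p : ℕ) (x : ℝ) : ℝ :=
  splitD p x / (splitD p x - 1)

/-- The error term `E`. With `x = p ^ α` the factor `x ^ (-1/4)` is `p ^ (-α/4)`. -/
noncomputable def errE (p : ℕ) (x : ℝ) : ℝ :=
  (Real.log p) ^ (1 / 2 : ℝ) *
    (6 / Real.pi ^ 2 *
        ((pvConst p) ^ (1 / 2 : ℝ) + splitDHat p x * (pvConst p) ^ (1 / 2 : ℝ)
          - (p : ℝ) ^ (-1 / 4 : ℝ) * (Real.log p) ^ (-1 / 2 : ℝ))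
      + cipuConst *
        ((p : ℝ) ^ (1 / 8 : ℝ) * x ^ (-1 / 4 : ℝ) * (pvConst p) ^ (3 / 4 : ℝ)
            * (Real.log p) ^ (1 / 4 : ℝ)
          - 1 / 3 * ((p : ℝ) ^ (-1 / 4 : ℝ) * x ^ (-1 / 4 : ℝ) * (Real.log p) ^ (1 / 2 : ℝ))
          + 7 / 3 * ((p : ℝ) ^ (1 / 8 : ℝ) * x ^ (-1 / 4 : ℝ) * (Real.log p) ^ (1 / 4 : ℝ)
            * (pvConst p) ^ (3 / 4 : ℝ))))

/-- `δ = 1 - ∑ 1/p_i` for the sieving primes `q 0, …, q (s-1)`. -/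
noncomputable def sieveDelta {s : ℕ} (q : Fin s → ℕ) : ℝ :=
  1 - ∑ i, 1 / (q i : ℝ)

/-- `Δ = (s - 1)/δ + 2`. -/
noncomputable def sieveBigDelta {s : ℕ} (q : Fin s → ℕ) : ℝ :=
  ((s : ℝ) - 1) / sieveDelta q + 2

/-- `G_s(x)`, for the core `k` and the sieving primes `q`. -/
noncomputable def sieveG (p k : ℕ) {s : ℕ} (q : Fin s → ℕ) (x : ℝ) : ℝ :=
  x ^ (1 / 2 : ℝ) * (p : ℝ) ^ (-1 / 4 : ℝ)
    - Real.pi ^ 2 / 6 *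
      (0.104 / (p : ℝ) ^ (1 / 4 : ℝ)
        + ((2 : ℝ) ^ (ArithmeticFunction.cardDistinctFactors k) * sieveBigDelta q + 1)
          * errE p x)

/-- `Rad(p - 1) = k p_1 ⋯ p_s` with distinct primes `p_i = q i`, `s ≥ 1`, where `k` is the product
of the smallest `ω(p - 1) - s` primes dividing `p - 1`. As `Rad(p - 1)` is square-free, `k` is the
product of the remaining `ω(p - 1) - s` primes; they are the smallest ones exactly when each
of them is below every `q i`. -/
structure IsSieving (p k : ℕ) {s : ℕ} (q : Fin s → ℕ) : Prop where
  one_le : 1 ≤ s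
  prime : ∀ i, (q i).Prime
  injective : Function.Injective q
  rad_eq : UniqueFactorizationMonoid.radical (p - 1) = k * ∏ i, q i
  core_smallest : ∀ r ∈ k.primeFactors, ∀ i, r < q i

end SquarefreePrimitiveRoot

/-! An integer prime to `p` is a primitive root exactly when, for each prime `r ∣ p - 1`, a
character of order `r` does not take the value 1 on it. A sieve over these conditions reduces the
theorem to two explicit estimates: a lower bound for the number of square-free integers below `x`,
and an upper bound for nonprincipal character sums over them.

The character sums rest on a Pólya–Vinogradov inequality (`polya_vinogradov`). The sum is averaged
over short shifts and completed with Gauss sums. Low frequencies lead to sums of `|sin (aφ)| / a`,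
bounded through the positivity of the Fejér kernel; this is the origin of the factor `1 / (π√2)`.
High frequencies telescope through cotangents. The square-free condition is then opened as a sum of
`μ(d)` over `d² ∣ n` and split at `D`: Pólya–Vinogradov for `d ≤ D`, the trivial bound beyond. The
weights in `d` are controlled by `abs_sqfreeCount_sub_le`, which has error `A√x`; it comes from a
Chebyshev-type bound for the Mertens function when `x ≥ 4225` and from computation below. The result
is `norm_sum_squarefree_mulChar_le_charErr`, with error `E √x p^(1/4)`.

In the sieve (`exists_apply_ne_one`) the primes of `k` are treated exactly and the `q i` by a union
bound. Each weight for `r` is an average of characters up to sign, so every expanded term costs one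
error, and the sieve needs only `2^ω(k) Δ - 1` of them. The hypothesis pays for `2^ω(k) Δ + 1`; the
two spare errors and the `0.104` absorb the error in the square-free count, the multiples of `p` and
the strictness of `g < x`. This requires `√x < 3.3 p`. For larger `x`, every reduced residue class
contains a square-free number below `x`, by elementary counting. -/

namespace SquarefreePrimitiveRoot
-- Fejér's kernel and harmonic sums of `|sin|`
open Finset

/-- The Dirichlet kernel `1/2 + ∑_{1 ≤ a ≤ n} cos (a φ)`. -/
noncomputable def dirichletKernel (φ : ℝ) (n : ℕ) : ℝ :=
  1 / 2 + ∑ a ∈ range n, Real.cos ((a + 1 : ℝ) * φ)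

/-- The (unnormalised) Fejér kernel. -/
noncomputable def fejerKernel (φ : ℝ) (n : ℕ) : ℝ :=
  ∑ t ∈ range (n + 1), dirichletKernel φ t

lemma dirichletKernel_succ (φ : ℝ) (n : ℕ) :
    dirichletKernel φ (n + 1) = dirichletKernel φ n + Real.cos ((n + 1 : ℝ) * φ) := by
  simp only [dirichletKernel, sum_range_succ]; ring

lemma two_mul_one_sub_cos_mul_dirichletKernel (φ : ℝ) (n : ℕ) :
    2 * (1 - Real.cos φ) * dirichletKernel φ n
      = Real.cos (n * φ) - Real.cos ((n + 1 : ℝ) * φ) := by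
  induction n with
  | zero => simp [dirichletKernel]; ring
  | succ n ih =>
    rw [dirichletKernel_succ, mul_add, ih]
    have h1 : Real.cos (n * φ) = Real.cos ((n + 1 : ℝ) * φ - φ) := by congr 1; ring
    have h2 : Real.cos (((n + 1 : ℕ) + 1 : ℝ) * φ) = Real.cos ((n + 1 : ℝ) * φ + φ) := by
      congr 1; push_cast; ring
    rw [h1, h2, Real.cos_sub, Real.cos_add]; push_cast; ring

lemma two_mul_one_sub_cos_mul_fejerKernel (φ : ℝ) (n : ℕ) :
    2 * (1 - Real.cos φ) * fejerKernel φ n = 1 - Real.cos ((n + 1 : ℝ) * φ) := by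
  induction n with
  | zero => simp [fejerKernel, dirichletKernel]; ring
  | succ n ih =>
    rw [fejerKernel, sum_range_succ, mul_add, ← fejerKernel, ih,
      two_mul_one_sub_cos_mul_dirichletKernel]
    push_cast; ring

/-- The closed form settles the case `cos φ < 1`; when `cos φ = 1` it degenerates, but then all the
cosines equal 1. -/
lemma fejerKernel_nonneg (φ : ℝ) (n : ℕ) : 0 ≤ fejerKernel φ n := by
  rcases eq_or_lt_of_le (Real.cos_le_one φ) with h | h
  · obtain ⟨m, hm⟩ := (Real.cos_eq_one_iff φ).mp h
    have hc (a : ℕ) : Real.cos ((a + 1 : ℝ) * φ) = 1 := by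
      rw [← hm]
      have := Real.cos_int_mul_two_pi ((a + 1) * m)
      push_cast at this
      rwa [mul_assoc] at this
    exact sum_nonneg fun t _ => by
      simp only [dirichletKernel, hc]; positivity
  · have h1 := two_mul_one_sub_cos_mul_fejerKernel φ n
    have h2 := Real.cos_le_one ((n + 1 : ℝ) * φ)
    by_contra hneg
    nlinarith

/-- Summation by parts replaces Dirichlet kernels by Fejér kernels with coefficients `u t - u (t +
1) ≥ 0`. The loss `u 0 / 2` is the initial Fejér kernel, which equals `1 / 2`. -/
lemma sum_mul_dirichletKernel_ge (φ : ℝ) {u : ℕ → ℝ} (hu : Antitone u) (n : ℕ) :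
    u n * fejerKernel φ (n + 1) - u 0 / 2
      ≤ ∑ t ∈ range (n + 1), u t * dirichletKernel φ (t + 1) := by
  induction n with
  | zero => simp [fejerKernel, sum_range_succ, dirichletKernel]; ring_nf; exact le_rfl
  | succ n ih =>
    rw [sum_range_succ]
    have h1 : fejerKernel φ (n + 1 + 1)
        = fejerKernel φ (n + 1) + dirichletKernel φ (n + 1 + 1) := by
      rw [fejerKernel, sum_range_succ, ← fejerKernel]
    have h2 := mul_le_mul_of_nonneg_right (hu (Nat.le_succ n)) (fejerKernel_nonneg φ (n + 1))
    rw [h1]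
    simp only [Nat.succ_eq_add_one] at h2
    linarith

lemma sum_cos_div_eq (φ : ℝ) (n : ℕ) :
    ∑ a ∈ range n, Real.cos ((a + 1 : ℝ) * φ) / (a + 1)
      = ∑ t ∈ range n, 1 / ((t + 1 : ℝ) * (t + 2)) * (dirichletKernel φ (t + 1) - 1 / 2)
        + (dirichletKernel φ n - 1 / 2) / (n + 1) := by
  induction n with
  | zero => simp [dirichletKernel]
  | succ n ih =>
    rw [sum_range_succ, sum_range_succ, ih, dirichletKernel_succ]
    push_cast
    have h1 : (n + 1 : ℝ) ≠ 0 := by positivity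
    have h2 : (n + 2 : ℝ) ≠ 0 := by positivity
    have h3 : (n + 1 + 1 : ℝ) ≠ 0 := by positivity
    field_simp
    ring_nf

lemma sum_one_div_mul_succ (n : ℕ) :
    ∑ t ∈ range n, 1 / ((t + 1 : ℝ) * (t + 2)) = 1 - 1 / (n + 1) := by
  induction n with
  | zero => simp
  | succ n ih =>
    rw [sum_range_succ, ih]
    push_cast
    have h1 : (n + 1 : ℝ) ≠ 0 := by positivity
    have h2 : (n + 2 : ℝ) ≠ 0 := by positivity
    have h3 : (n + 1 + 1 : ℝ) ≠ 0 := by positivity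
    field_simp
    ring

/-- Cosine sums with harmonic weights are bounded below. -/
lemma sum_cos_div_ge (φ : ℝ) (n : ℕ) :
    -(7 / 4) ≤ ∑ a ∈ range n, Real.cos ((a + 1 : ℝ) * φ) / (a + 1) := by
  rcases n with - | n
  · norm_num
  -- The constant is `7/4 = 1/4 + 1/2 + 1`: half of `u 0 = 1/2`, the subtracted `1/2` weighted by a
  -- sum below 1, and the boundary term.
  have hu : Antitone fun t : ℕ => 1 / ((t + 1 : ℝ) * (t + 2)) := by
    refine antitone_nat_of_succ_le fun t => ?_
    push_cast
    gcongr <;> linarith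
  have h1 := sum_mul_dirichletKernel_ge φ hu n
  have h2 : 0 ≤ 1 / ((n + 1 : ℝ) * (n + 2)) * fejerKernel φ (n + 1) :=
    mul_nonneg (by positivity) (fejerKernel_nonneg _ _)
  have h3 : -((n + 1 : ℕ) : ℝ) ≤ dirichletKernel φ (n + 1) - 1 / 2 := by
    have : ∑ a ∈ range (n + 1), (-1 : ℝ) ≤ ∑ a ∈ range (n + 1), Real.cos ((a + 1 : ℝ) * φ) :=
      sum_le_sum fun a _ => Real.neg_one_le_cos _
    simp only [sum_const, card_range, nsmul_eq_mul, mul_neg, mul_one] at this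
    simp only [dirichletKernel]; linarith
  have h4 : -1 ≤ (dirichletKernel φ (n + 1) - 1 / 2) / (((n + 1 : ℕ) : ℝ) + 1) := by
    rw [le_div_iff₀ (by positivity)]; linarith
  rw [sum_cos_div_eq]
  simp only [mul_sub, sum_sub_distrib, ← sum_mul]
  rw [sum_one_div_mul_succ]
  have h5 : (0 : ℝ) ≤ ((n : ℝ) + 1 + 1)⁻¹ := by positivity
  norm_num at h1 h2
  norm_num
  norm_num at h4
  linarith

/-- This is `(√2 |sin y| - 1)² ≥ 0`. It trades the absolute value for a cosine, whose harmonic sums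
are bounded below. -/
lemma abs_sin_le (y : ℝ) : |Real.sin y| ≤ 1 / √2 * (1 - Real.cos (2 * y) / 2) := by
  have h2 : (0 : ℝ) < √2 := by positivity
  have hs : √2 * √2 = 2 := Real.mul_self_sqrt (by norm_num)
  rw [Real.cos_two_mul, div_mul_eq_mul_div, one_mul, le_div_iff₀ h2]
  have h3 := Real.sin_sq_add_cos_sq y
  rw [← sq_abs (Real.sin y)] at h3
  nlinarith [sq_nonneg (√2 * |Real.sin y| - 1)]

lemma sum_abs_sin_div_le (φ : ℝ) (n : ℕ) :
    ∑ a ∈ range n, |Real.sin ((a + 1 : ℝ) * φ)| / (a + 1)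
      ≤ 1 / √2 * (∑ a ∈ range n, 1 / (a + 1 : ℝ) + 7 / 8) := by
  have h : ∑ a ∈ range n, |Real.sin ((a + 1 : ℝ) * φ)| / (a + 1)
      ≤ ∑ a ∈ range n, 1 / √2 * (1 / (a + 1 : ℝ)
        - Real.cos ((a + 1 : ℝ) * (2 * φ)) / (a + 1) / 2) := by
    refine sum_le_sum fun a _ => ?_
    have := abs_sin_le ((a + 1 : ℝ) * φ)
    have ha : (0 : ℝ) < a + 1 := by positivity
    rw [div_le_iff₀ ha]
    refine this.trans (le_of_eq ?_)
    rw [show 2 * ((a + 1 : ℝ) * φ) = (a + 1 : ℝ) * (2 * φ) by ring]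
    field_simp
  refine h.trans ?_
  rw [← mul_sum, sum_sub_distrib, ← sum_div]
  have := sum_cos_div_ge (2 * φ) n
  gcongr
  linarith

end SquarefreePrimitiveRoot

/-! ### Gauss sums, completion and averaging over shifts -/

namespace SquarefreePrimitiveRoot
open Finset

lemma norm_gaussSum_sq {p : ℕ} [Fact p.Prime] {χ : MulChar (ZMod p) ℂ} (hχ : χ ≠ 1) :
    ‖gaussSum χ ZMod.stdAddChar‖ ^ 2 = p := by
  have h := gaussSum_mul_gaussSum_eq_card hχ (ZMod.isPrimitive_stdAddChar p)
  rw [← star_gaussSum_eq, ZMod.card, ← starRingEnd_apply, Complex.mul_conj,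
    Complex.normSq_eq_norm_sq] at h
  exact_mod_cast h

lemma apply_mul_gaussSum_inv {p : ℕ} [Fact p.Prime] {χ : MulChar (ZMod p) ℂ} (hχ : χ ≠ 1) (m : ZMod p) :
    χ m * gaussSum χ⁻¹ ZMod.stdAddChar
      = ∑ a : ZMod p, χ⁻¹ a * ZMod.stdAddChar (m * a) := by
  rcases eq_or_ne m 0 with rfl | hm
  · have := MulChar.sum_eq_zero_of_ne_one (inv_ne_one.mpr hχ)
    simp [this, MulChar.map_nonunit χ not_isUnit_zero]
  · have := gaussSum_mulShift_eq χ⁻¹ (ZMod.stdAddChar (N := p)) (Units.mk0 m hm)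
    rw [inv_inv] at this
    simpa [gaussSum] using this.symm

lemma norm_mulChar_le_one {p : ℕ} (χ : MulChar (ZMod p) ℂ) (a : ZMod p) : ‖χ a‖ ≤ 1 :=
  DirichletCharacter.norm_le_one (n := p) χ a

/-- Each `χ (c i)` is expanded in additive characters by the Gauss sum of `χ⁻¹`, of modulus `√p`.
The family is arbitrary so that pairs (shift, position) can serve as indices. -/
lemma norm_sum_mulChar_le {p : ℕ} [Fact p.Prime] {χ : MulChar (ZMod p) ℂ} (hχ : χ ≠ 1) {ι : Type*} (s : Finset ι)
    (c : ι → ZMod p) :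
    √p * ‖∑ i ∈ s, χ (c i)‖
      ≤ ∑ a ∈ univ.erase (0 : ZMod p), ‖∑ i ∈ s, ZMod.stdAddChar (c i * a)‖ := by
  have h1 : ‖gaussSum χ⁻¹ (ZMod.stdAddChar (N := p))‖ = √p := by
    rw [← norm_gaussSum_sq (inv_ne_one.mpr hχ), Real.sqrt_sq (norm_nonneg _)]
  rw [← h1, ← norm_mul, mul_comm, sum_mul]
  simp_rw [apply_mul_gaussSum_inv hχ]
  rw [sum_comm, ← sum_erase (univ : Finset (ZMod p)) (a := 0)]
  · refine (norm_sum_le _ _).trans (sum_le_sum fun a _ => ?_)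
    rw [← mul_sum, norm_mul]
    exact mul_le_of_le_one_left (norm_nonneg _) (norm_mulChar_le_one _ _)
  · simp [MulChar.map_nonunit χ⁻¹ not_isUnit_zero]

lemma norm_sum_exp_mul_abs_sin (θ : ℝ) (n : ℕ) :
    ‖∑ m ∈ range n, Complex.exp (Complex.I * ((2 * θ : ℝ) : ℂ)) ^ m‖ * |Real.sin θ|
      = |Real.sin (n * θ)| := by
  have h1 := Complex.norm_exp_I_mul_ofReal_sub_one (2 * θ)
  have h2 := Complex.norm_exp_I_mul_ofReal_sub_one (2 * (n * θ))
  have h3 := geom_sum_mul (Complex.exp (Complex.I * ((2 * θ : ℝ) : ℂ))) n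
  rw [← Complex.exp_nat_mul] at h3
  rw [show (n : ℂ) * (Complex.I * ((2 * θ : ℝ) : ℂ))
    = Complex.I * ((2 * (n * θ) : ℝ) : ℂ) by push_cast; ring] at h3
  have h4 := congrArg norm h3
  rw [norm_mul, h1, h2, mul_div_cancel_left₀ _ two_ne_zero,
    mul_div_cancel_left₀ _ two_ne_zero, norm_mul, norm_mul, Real.norm_eq_abs, Real.norm_eq_abs,
    Real.norm_eq_abs, abs_two] at h4
  linarith

lemma stdAddChar_natCast_mul {p : ℕ} [NeZero p] (m j : ℕ) :
    (ZMod.stdAddChar ((m : ZMod p) * (j : ZMod p)) : ℂ)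
      = Complex.exp (Complex.I * ((2 * (Real.pi * j / p) : ℝ) : ℂ)) ^ m := by
  have := ZMod.stdAddChar_coe (N := p) ((m * j : ℕ) : ℤ)
  push_cast at this
  rw [this, ← Complex.exp_nat_mul]
  congr 1
  push_cast; ring

lemma norm_sum_stdAddChar_mul_abs_sin {p : ℕ} [NeZero p] (j n : ℕ) :
    ‖∑ m ∈ range n, (ZMod.stdAddChar ((m : ZMod p) * (j : ZMod p)) : ℂ)‖
      * |Real.sin (Real.pi * j / p)| = |Real.sin (n * (Real.pi * j / p))| := by
  simp_rw [stdAddChar_natCast_mul]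
  exact norm_sum_exp_mul_abs_sin _ _

lemma norm_stdAddChar {p : ℕ} [NeZero p] (a : ZMod p) : ‖(ZMod.stdAddChar a : ℂ)‖ = 1 := by simp

lemma norm_sum_shift_sub_le {f : ℤ → ℂ} (hf : ∀ m, ‖f m‖ ≤ 1) (n k : ℕ) :
    ‖∑ m ∈ range n, f m - ∑ m ∈ range n, f (m + k)‖ ≤ 2 * k := by
  have h1 := sum_range_add (fun m : ℕ => f m) n k
  have h2 := sum_range_add (fun m : ℕ => f m) k n
  rw [add_comm k n, h1] at h2
  have h3 : ∑ m ∈ range n, f m - ∑ m ∈ range n, f (m + k)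
      = ∑ m ∈ range k, f m - ∑ m ∈ range k, f ((n + m : ℕ) : ℤ) := by
    have : ∑ m ∈ range n, f (m + k) = ∑ m ∈ range n, f ((k + m : ℕ) : ℤ) :=
      sum_congr rfl fun m _ => by push_cast; rw [add_comm]
    rw [this]
    linear_combination h2
  rw [h3]
  have h4 : ‖∑ m ∈ range k, f m‖ ≤ k := by
    simpa using norm_sum_le_of_le (range k) (f := fun m : ℕ => f m) fun m _ => hf m
  have h5 : ‖∑ m ∈ range k, f ((n + m : ℕ) : ℤ)‖ ≤ k := by
    simpa using norm_sum_le_of_le (range k) (f := fun m : ℕ => f ((n + m : ℕ) : ℤ))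
      fun m _ => hf _
  linarith [norm_sub_le (∑ m ∈ range k, f m) (∑ m ∈ range k, f ((n + m : ℕ) : ℤ))]

/-- A shift by `k` alters at most `k` terms at each end, hence costs `2k`; over the shifts from `-l`
to `l` this totals `2l(l + 1)`. Averaging supplies a second sine factor, which makes the completed
sum decay quadratically in the frequency. -/
lemma sum_shift_average_le {f : ℤ → ℂ} (hf : ∀ m, ‖f m‖ ≤ 1) (n l : ℕ) :
    (2 * l + 1) * ‖∑ m ∈ range n, f m‖
      ≤ ‖∑ h ∈ range (l + (l + 1)), ∑ m ∈ range n, f (m + h - l)‖ + 2 * l * (l + 1) := by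
  set S := ∑ m ∈ range n, f m with hS
  have hsum : ∑ h ∈ range (l + (l + 1)), (S - ∑ m ∈ range n, f (m + h - l))
      = (2 * l + 1) * S - ∑ h ∈ range (l + (l + 1)), ∑ m ∈ range n, f (m + h - l) := by
    rw [sum_sub_distrib, sum_const, card_range, nsmul_eq_mul]; push_cast; ring
  have hR : ∀ h ∈ range (l + 1), ‖S - ∑ m ∈ range n, f (m + (l + h : ℕ) - l)‖ ≤ 2 * h := by
    intro h _
    have e : ∑ m ∈ range n, f (m + (l + h : ℕ) - l) = ∑ m ∈ range n, f (m + h) :=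
      sum_congr rfl fun m _ => by congr 1; push_cast; ring
    rw [e]
    exact norm_sum_shift_sub_le hf n h
  have hL : ∀ h ∈ range l, ‖S - ∑ m ∈ range n, f (m + h - l)‖ ≤ 2 * (l - h : ℝ) := by
    intro h hh
    have hle : h ≤ l := (mem_range.mp hh).le
    have := norm_sum_shift_sub_le (f := fun m => f (m + h - l)) (fun m => hf _) n (l - h)
    have e : ∑ m ∈ range n, f (m + (l - h : ℕ) + h - l) = S :=
      sum_congr rfl fun m _ => by congr 1; push_cast [hle]; ring
    rwa [norm_sub_rev, e, Nat.cast_sub hle] at this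
  have h2 : ‖∑ h ∈ range (l + (l + 1)), (S - ∑ m ∈ range n, f (m + h - l))‖
      ≤ 2 * l * (l + 1) := by
    rw [sum_range_add]
    refine (norm_add_le _ _).trans ((add_le_add (norm_sum_le_of_le _ hL)
      (norm_sum_le_of_le _ hR)).trans (le_of_eq ?_))
    have e1 : ∀ k : ℕ, ∑ h ∈ range k, (2 * (h : ℝ)) = k * (k - 1) := by
      intro k
      induction k with
      | zero => simp
      | succ k ih => rw [sum_range_succ, ih]; push_cast; ring
    rw [e1]
    simp_rw [mul_sub]
    rw [sum_sub_distrib, e1, sum_const, card_range, nsmul_eq_mul]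
    push_cast; ring
  rw [hsum] at h2
  have h3 := norm_sub_norm_le ((2 * l + 1) * S)
    (∑ h ∈ range (l + (l + 1)), ∑ m ∈ range n, f (m + h - l))
  have h4 : ‖((2 * l + 1) * S : ℂ)‖ = (2 * l + 1) * ‖S‖ := by
    rw [norm_mul]
    congr 1
    have : ((2 * l + 1 : ℂ)) = ((2 * l + 1 : ℕ) : ℂ) := by push_cast; rfl
    rw [this, Complex.norm_natCast]; push_cast; rfl
  linarith

end SquarefreePrimitiveRoot

namespace SquarefreePrimitiveRoot
open Finset

lemma sum_zmod_eq_sum_range {p : ℕ} [NeZero p] (f : ZMod p → ℝ) :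
    ∑ a, f a = ∑ j ∈ range p, f j := by
  refine sum_nbij' (fun a => a.val) (fun j => (j : ZMod p)) ?_ ?_ ?_ ?_ ?_
  · intro a _; simpa using ZMod.val_lt a
  · simp
  · intro a _; simp
  · intro j hj; exact ZMod.val_cast_of_lt (by simpa using hj)
  · intro a _; simp

lemma sum_erase_zero_zmod {p h : ℕ} [NeZero p] (hp : p = 2 * h + 1) {f : ZMod p → ℝ}
    (hf : ∀ a, f (-a) = f a) :
    ∑ a ∈ univ.erase (0 : ZMod p), f a = 2 * ∑ j ∈ range h, f ((j + 1 : ℕ) : ZMod p) := by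
  have h1 := add_sum_erase univ f (mem_univ (0 : ZMod p))
  have h2 : ∑ a, f a = ∑ j ∈ range (h + h), f ((j + 1 : ℕ) : ZMod p) + f 0 := by
    rw [sum_zmod_eq_sum_range]
    have h3 : range p = range (h + h + 1) := by rw [hp]; congr 1; ring
    rw [h3, sum_range_succ' (fun j : ℕ => f (j : ZMod p))]
    simp
  have h4 : ∑ j ∈ range h, f ((h + j + 1 : ℕ) : ZMod p)
      = ∑ j ∈ range h, f ((j + 1 : ℕ) : ZMod p) := by
    rw [← sum_range_reflect]
    refine sum_congr rfl fun j hj => ?_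
    have hj := mem_range.mp hj
    rw [← hf]
    congr 1
    rw [neg_eq_iff_add_eq_zero, ← Nat.cast_add,
      show h + (h - 1 - j) + 1 + (j + 1) = p by omega, ZMod.natCast_self]
  rw [sum_range_add, h4] at h2
  linarith

lemma sin_pi_mul_div_pos {p j : ℕ} (hj : 0 < j) (hjp : j < p) :
    0 < Real.sin (Real.pi * j / p) := by
  have hp : (0 : ℝ) < p := by exact_mod_cast hj.trans hjp
  have hj' : (0 : ℝ) < j := by exact_mod_cast hj
  have hjp' : (j : ℝ) < p := by exact_mod_cast hjp
  apply Real.sin_pos_of_pos_of_lt_pi (by positivity)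
  rw [div_lt_iff₀ hp]
  exact mul_lt_mul_of_pos_left hjp' Real.pi_pos

/-- Smoothed completion of a character sum over an initial interval. -/
lemma norm_sum_mulChar_range_le {p h : ℕ} [Fact p.Prime] (hp : p = 2 * h + 1)
    {χ : MulChar (ZMod p) ℂ} (hχ : χ ≠ 1) (n l : ℕ) :
    (2 * l + 1) * ‖∑ m ∈ range n, χ (m : ZMod p)‖
      ≤ 2 / √p * ∑ j ∈ range h,
          |Real.sin (n * (Real.pi * (j + 1 : ℕ) / p))|
            * |Real.sin ((2 * l + 1 : ℕ) * (Real.pi * (j + 1 : ℕ) / p))|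
            / Real.sin (Real.pi * (j + 1 : ℕ) / p) ^ 2
        + 2 * l * (l + 1) := by
  have hsq : 0 < √(p : ℝ) := Real.sqrt_pos.mpr (by exact_mod_cast (Fact.out : p.Prime).pos)
  have h1 := sum_shift_average_le (f := fun m : ℤ => χ (m : ZMod p))
    (fun m => norm_mulChar_le_one _ _) n l
  have h2 := norm_sum_mulChar_le hχ (range (l + (l + 1)) ×ˢ range n)
    (fun i => ((i.2 + i.1 - l : ℤ) : ZMod p))
  -- The double exponential sum factors into two geometric sums, up to the unimodular phase of the
  -- shift by `-l`.
  have hfac (a : ZMod p) : ‖∑ i ∈ range (l + (l + 1)) ×ˢ range n,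
      (ZMod.stdAddChar (((i.2 + i.1 - l : ℤ) : ZMod p) * a) : ℂ)‖
      = ‖∑ h ∈ range (l + (l + 1)), (ZMod.stdAddChar ((h : ZMod p) * a) : ℂ)‖
        * ‖∑ m ∈ range n, (ZMod.stdAddChar ((m : ZMod p) * a) : ℂ)‖ := by
    have : ∑ i ∈ range (l + (l + 1)) ×ˢ range n,
      (ZMod.stdAddChar (((i.2 + i.1 - l : ℤ) : ZMod p) * a) : ℂ)
      = (∑ h ∈ range (l + (l + 1)), (ZMod.stdAddChar ((h : ZMod p) * a) : ℂ))
        * (∑ m ∈ range n, (ZMod.stdAddChar ((m : ZMod p) * a) : ℂ))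
        * ZMod.stdAddChar (-(l : ZMod p) * a) := by
      rw [sum_mul_sum, ← sum_product', sum_mul]
      refine sum_congr rfl fun i _ => ?_
      rw [← AddChar.map_add_eq_mul, ← AddChar.map_add_eq_mul]
      congr 1
      push_cast; ring
    rw [this, norm_mul, norm_mul, norm_stdAddChar, mul_one]
  simp_rw [hfac] at h2
  rw [sum_erase_zero_zmod hp, sum_product] at h2
  · have h3 : ∑ j ∈ range h,
        ‖∑ h ∈ range (l + (l + 1)), (ZMod.stdAddChar ((h : ZMod p) * ((j + 1 : ℕ) : ZMod p)) : ℂ)‖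
          * ‖∑ m ∈ range n, (ZMod.stdAddChar ((m : ZMod p) * ((j + 1 : ℕ) : ZMod p)) : ℂ)‖
        = ∑ j ∈ range h,
          |Real.sin (n * (Real.pi * (j + 1 : ℕ) / p))|
            * |Real.sin ((2 * l + 1 : ℕ) * (Real.pi * (j + 1 : ℕ) / p))|
            / Real.sin (Real.pi * (j + 1 : ℕ) / p) ^ 2 := by
      refine sum_congr rfl fun j hj => ?_
      have hs := sin_pi_mul_div_pos (p := p) (j := j + 1) (by omega)
        (by have := mem_range.mp hj; omega)
      rw [← norm_sum_stdAddChar_mul_abs_sin, ← norm_sum_stdAddChar_mul_abs_sin, abs_of_pos hs,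
        show 2 * l + 1 = l + (l + 1) by ring, eq_div_iff (pow_ne_zero 2 hs.ne')]
      ring
    rw [h3] at h2
    simp only [Int.cast_natCast] at h1
    refine h1.trans (add_le_add_left ?_ _)
    rw [div_mul_eq_mul_div, le_div_iff₀ hsq, mul_comm]
    exact h2
  · intro a
    have hneg (k : ℕ) : ‖∑ m ∈ range k, (ZMod.stdAddChar ((m : ZMod p) * -a) : ℂ)‖
        = ‖∑ m ∈ range k, (ZMod.stdAddChar ((m : ZMod p) * a) : ℂ)‖ := by
      rw [← RCLike.norm_conj, map_sum]
      congr 1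
      refine sum_congr rfl fun m _ => ?_
      rw [mul_neg, AddChar.map_neg_eq_conj, Complex.conj_conj]
    rw [hneg, hneg]

end SquarefreePrimitiveRoot

/-! ### Low and high frequencies in the completed sum -/

namespace SquarefreePrimitiveRoot
open Finset

lemma abs_sin_nat_mul_le (n : ℕ) (θ : ℝ) : |Real.sin (n * θ)| ≤ n * |Real.sin θ| := by
  induction n with
  | zero => simp
  | succ n ih =>
    rw [show ((n + 1 : ℕ) : ℝ) * θ = n * θ + θ by push_cast; ring, Real.sin_add]
    have h1 := abs_add_le (Real.sin (n * θ) * Real.cos θ) (Real.cos (n * θ) * Real.sin θ)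
    rw [abs_mul, abs_mul] at h1
    have h2 := mul_le_of_le_one_right (abs_nonneg (Real.sin (n * θ))) (Real.abs_cos_le_one θ)
    have h3 := mul_le_of_le_one_left (abs_nonneg (Real.sin θ)) (Real.abs_cos_le_one (n * θ))
    push_cast
    linarith

lemma one_div_sin_le {θ : ℝ} (h0 : 0 < θ) (h1 : θ ≤ 1) :
    1 / Real.sin θ ≤ 1 / θ + θ / 2 := by
  have hs := Real.sin_gt_sub_cube h0
  have hs0 : 0 < Real.sin θ := Real.sin_pos_of_pos_of_lt_pi h0 (by linarith [Real.pi_gt_three])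
  rw [div_add_div _ _ h0.ne' two_ne_zero, div_le_div_iff₀ hs0 (by positivity)]
  have h2 : θ ^ 2 ≤ 1 := by nlinarith
  nlinarith [mul_pos h0 h0, mul_pos (mul_pos h0 h0) h0]

/-- The right side is `sin η / (sin x sin (x + η))`, and sine increases up to `π/2`. With `η = π/p`
this telescopes the tail. -/
lemma one_div_sin_sq_le {x η : ℝ} (hx : 0 < x) (hη : 0 < η) (h : x + η ≤ Real.pi / 2) :
    Real.sin η * (1 / Real.sin (x + η) ^ 2)
      ≤ Real.cos x / Real.sin x - Real.cos (x + η) / Real.sin (x + η) := by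
  have hpi := Real.pi_pos
  have s1 : 0 < Real.sin x := Real.sin_pos_of_pos_of_lt_pi hx (by linarith)
  have s2 : 0 < Real.sin (x + η) := Real.sin_pos_of_pos_of_lt_pi (by linarith) (by linarith)
  have s3 : 0 < Real.sin η := Real.sin_pos_of_pos_of_lt_pi hη (by linarith)
  have hle : Real.sin x ≤ Real.sin (x + η) :=
    Real.sin_le_sin_of_le_of_le_pi_div_two (by linarith) h (by linarith)
  have e : Real.cos x / Real.sin x - Real.cos (x + η) / Real.sin (x + η)
      = Real.sin η / (Real.sin x * Real.sin (x + η)) := by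
    rw [div_sub_div _ _ s1.ne' s2.ne']
    congr 1
    have := Real.sin_sub (x + η) x
    rw [add_sub_cancel_left] at this
    linarith
  rw [e, mul_one_div, sq]
  gcongr

lemma sin_mul_sum_one_div_sin_sq_le {p h t : ℕ} (hp : p = 2 * h + 1) (ht : 1 ≤ t) (k : ℕ)
    (hk : t + k ≤ h) :
    Real.sin (Real.pi / p) * ∑ j ∈ range k, 1 / Real.sin (Real.pi * (t + j + 1 : ℕ) / p) ^ 2
      ≤ Real.cos (Real.pi * t / p) / Real.sin (Real.pi * t / p)
        - Real.cos (Real.pi * (t + k : ℕ) / p) / Real.sin (Real.pi * (t + k : ℕ) / p) := by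
  have hp0 : (0 : ℝ) < p := by exact_mod_cast (by omega : 0 < p)
  induction k with
  | zero => simp
  | succ k ih =>
    have ih := ih (by omega)
    rw [sum_range_succ, mul_add]
    have h1 := one_div_sin_sq_le (x := Real.pi * (t + k : ℕ) / p) (η := Real.pi / p)
      (by
        have : (0 : ℝ) < (t + k : ℕ) := by exact_mod_cast (by omega : 0 < t + k)
        have := Real.pi_pos
        positivity)
      (div_pos Real.pi_pos hp0)
      (by
        rw [← add_div, div_le_div_iff₀ hp0 two_pos]
        have : ((2 * (t + k + 1) : ℕ) : ℝ) ≤ p := by exact_mod_cast (by omega)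
        push_cast at this ⊢
        nlinarith [Real.pi_pos])
    have e : Real.pi * (t + k : ℕ) / p + Real.pi / p = Real.pi * (t + k + 1 : ℕ) / p := by
      push_cast; ring
    rw [e] at h1
    rw [← add_assoc t k 1]
    linarith

lemma sum_one_div_sin_sq_le {p h t : ℕ} (hp : p = 2 * h + 1) (ht : 1 ≤ t) (k : ℕ)
    (hk : t + k ≤ h) :
    Real.sin (Real.pi / p) * ∑ j ∈ range k, 1 / Real.sin (Real.pi * (t + j + 1 : ℕ) / p) ^ 2
      ≤ p / (Real.pi * t) := by
  have hp0 : (0 : ℝ) < p := by exact_mod_cast (by omega : 0 < p)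
  have ht0 : (0 : ℝ) < t := by exact_mod_cast ht
  have hpi := Real.pi_pos
  have hlt (a : ℕ) (ha : a ≤ h) : Real.pi * a / p < Real.pi / 2 := by
    rw [div_lt_div_iff₀ hp0 two_pos]
    have : ((2 * a : ℕ) : ℝ) < p := by exact_mod_cast (by omega)
    push_cast at this
    nlinarith
  have h1 := sin_mul_sum_one_div_sin_sq_le hp ht k hk
  have h2 : 0 ≤ Real.cos (Real.pi * (t + k : ℕ) / p) / Real.sin (Real.pi * (t + k : ℕ) / p) := by
    have h0 : 0 ≤ Real.pi * (t + k : ℕ) / p := by positivity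
    have := hlt (t + k) hk
    exact div_nonneg (Real.cos_nonneg_of_neg_pi_div_two_le_of_le (by linarith) this.le)
      (Real.sin_nonneg_of_nonneg_of_le_pi h0 (by linarith))
  have h0 : 0 < Real.pi * t / p := by positivity
  have h3 := Real.lt_tan h0 (hlt t (by omega))
  have h4 : Real.cos (Real.pi * t / p) / Real.sin (Real.pi * t / p) ≤ p / (Real.pi * t) := by
    rw [← inv_div, ← Real.tan_eq_sin_div_cos, ← inv_div (Real.pi * t)]
    exact inv_anti₀ h0 h3.le
  linarith

lemma sum_one_div_le_one_add_log (t : ℕ) :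
    ∑ a ∈ range t, 1 / (a + 1 : ℝ) ≤ 1 + Real.log t := by
  have := harmonic_le_one_add_log t
  simpa [harmonic] using this

/-- The completed sum, split at `t`. -/
lemma norm_sum_mulChar_range_le_split {p h : ℕ} [Fact p.Prime] (hp : p = 2 * h + 1) (hp37 : 37 ≤ p)
    {χ : MulChar (ZMod p) ℂ} (hχ : χ ≠ 1) (n l t : ℕ) (ht : 1 ≤ t) (hth : t ≤ h)
    (htp : Real.pi * t ≤ p) :
    ‖∑ m ∈ range n, χ (m : ZMod p)‖
      ≤ 2 / √p * (p / (Real.pi * √2) * (15 / 8 + Real.log t)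
          + Real.pi * t * (t + 1) / (4 * p)
          + 1.004 * p ^ 2 / (Real.pi ^ 2 * (t * (2 * l + 1))))
        + (2 * l + 1) / 2 := by
  have hp0 : (0 : ℝ) < p := by exact_mod_cast (by omega : 0 < p)
  have hp37' : (37 : ℝ) ≤ p := by exact_mod_cast hp37
  have hpi := Real.pi_pos
  have ht0 : (0 : ℝ) < t := by exact_mod_cast ht
  have hl : (0 : ℝ) < 2 * l + 1 := by positivity
  have hsq : 0 < √(p : ℝ) := Real.sqrt_pos.mpr hp0
  have hmain := norm_sum_mulChar_range_le hp hχ n l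
  set B : ℕ → ℝ := fun j => |Real.sin (n * (Real.pi * (j + 1 : ℕ) / p))|
            * |Real.sin ((2 * l + 1 : ℕ) * (Real.pi * (j + 1 : ℕ) / p))|
            / Real.sin (Real.pi * (j + 1 : ℕ) / p) ^ 2 with hB
  have hsin (j : ℕ) (hj : j < h) : 0 < Real.sin (Real.pi * (j + 1 : ℕ) / p) :=
    sin_pi_mul_div_pos (by omega) (by omega)
  -- Low frequencies: the shift factor is at most `(2l + 1) sin θ`, leaving `|sin (nθ)| / sin θ`
  -- with `1 / sin θ ≤ 1/θ + θ/2`. Here `15/8` is `7/8` plus the 1 of the harmonic bound.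
  have hlow : ∑ j ∈ range t, B j ≤ (2 * l + 1) * (p / (Real.pi * √2) * (15 / 8 + Real.log t)
      + Real.pi * t * (t + 1) / (4 * p)) := by
    have h1 : ∀ j ∈ range t, B j ≤ (2 * l + 1)
        * (p / Real.pi * (|Real.sin ((j + 1 : ℝ) * (n * Real.pi / p))| / (j + 1))
          + Real.pi / (2 * p) * (j + 1)) := by
      intro j hj
      have hjt := mem_range.mp hj
      have s0 := hsin j (by omega)
      have a1 := abs_sin_nat_mul_le (2 * l + 1) (Real.pi * (j + 1 : ℕ) / p)
      rw [abs_of_pos s0] at a1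
      have a2 : B j ≤ (2 * l + 1) * (|Real.sin (n * (Real.pi * (j + 1 : ℕ) / p))|
          * (1 / Real.sin (Real.pi * (j + 1 : ℕ) / p))) := by
        rw [hB]
        rw [div_le_iff₀ (by positivity)]
        calc _ ≤ |Real.sin (n * (Real.pi * (j + 1 : ℕ) / p))|
                * ((2 * l + 1 : ℕ) * Real.sin (Real.pi * (j + 1 : ℕ) / p)) := by gcongr
          _ = _ := by push_cast; field_simp
      have hθ0 : 0 < Real.pi * (j + 1 : ℕ) / p := by positivity
      have hθ1 : Real.pi * (j + 1 : ℕ) / p ≤ 1 := by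
        rw [div_le_one hp0]
        refine le_trans ?_ htp
        gcongr
        exact_mod_cast hjt
      have a3 := one_div_sin_le hθ0 hθ1
      refine a2.trans ?_
      gcongr
      calc |Real.sin (n * (Real.pi * (j + 1 : ℕ) / p))| * (1 / Real.sin (Real.pi * (j + 1 : ℕ) / p))
          ≤ |Real.sin (n * (Real.pi * (j + 1 : ℕ) / p))|
            * (1 / (Real.pi * (j + 1 : ℕ) / p) + Real.pi * (j + 1 : ℕ) / p / 2) := by gcongr
        _ ≤ |Real.sin (n * (Real.pi * (j + 1 : ℕ) / p))| * (1 / (Real.pi * (j + 1 : ℕ) / p))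
            + Real.pi * (j + 1 : ℕ) / p / 2 := by
          rw [mul_add]
          gcongr
          exact mul_le_of_le_one_left (by positivity) (Real.abs_sin_le_one _)
        _ = _ := by
          have e : n * (Real.pi * (j + 1 : ℕ) / p) = (j + 1 : ℝ) * (n * Real.pi / p) := by
            push_cast; ring
          rw [e]
          push_cast
          field_simp
    refine (sum_le_sum h1).trans ?_
    rw [← mul_sum, sum_add_distrib, ← mul_sum, ← mul_sum]
    have e1 : ∀ k : ℕ, ∑ j ∈ range k, ((j : ℝ) + 1) = k * (k + 1) / 2 := by
      intro k
      induction k with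
      | zero => simp
      | succ k ih => rw [sum_range_succ, ih]; push_cast; ring
    have e2 := sum_abs_sin_div_le (n * Real.pi / p) t
    have e3 := sum_one_div_le_one_add_log t
    rw [e1]
    refine mul_le_mul_of_nonneg_left (add_le_add ?_ (le_of_eq (by field_simp; ring))) hl.le
    calc p / Real.pi * ∑ a ∈ range t, |Real.sin ((a + 1 : ℝ) * (n * Real.pi / p))| / (a + 1)
        ≤ p / Real.pi * (1 / √2 * (1 + Real.log t + 7 / 8)) := by
          refine mul_le_mul_of_nonneg_left (e2.trans ?_) (by positivity)
          gcongr
      _ = _ := by field_simp; ring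
  -- High frequencies: both sines in the numerator are bounded by 1. The factor `1.004` replaces
  -- `sin (π/p)` by `π/p` for `p ≥ 37`.
  have hhigh : ∑ j ∈ range (h - t), B (t + j) ≤ 1.004 * p ^ 2 / (Real.pi ^ 2 * t) := by
    have h1 : ∑ j ∈ range (h - t), B (t + j)
        ≤ ∑ j ∈ range (h - t), 1 / Real.sin (Real.pi * (t + j + 1 : ℕ) / p) ^ 2 := by
      refine sum_le_sum fun j hj => ?_
      have s0 := hsin (t + j) (by have := mem_range.mp hj; omega)
      exact div_le_div_of_nonneg_right
        (mul_le_one₀ (Real.abs_sin_le_one _) (abs_nonneg _) (Real.abs_sin_le_one _)) (sq_nonneg _)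
    have h2 := sum_one_div_sin_sq_le hp ht (h - t) (by omega)
    have hη0 : 0 < Real.pi / p := by positivity
    have hη1 : Real.pi / p ≤ 0.0852 := by
      rw [div_le_iff₀ hp0]; nlinarith [Real.pi_lt_d4]
    have hη : 0 < Real.sin (Real.pi / p) :=
      Real.sin_pos_of_pos_of_lt_pi hη0 (by linarith [Real.pi_gt_three])
    have h3 := one_div_sin_le hη0 (by linarith)
    rw [mul_comm, ← le_div_iff₀ hη] at h2
    refine h1.trans (h2.trans ?_)
    rw [div_eq_mul_one_div]
    have h4 : 1 / Real.sin (Real.pi / p) ≤ 1.004 * (p / Real.pi) := by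
      refine h3.trans ?_
      have : Real.pi / p / 2 ≤ 0.004 * (p / Real.pi) := by
        have : 11 ≤ (p : ℝ) / Real.pi := by
          rw [le_div_iff₀ hpi]; nlinarith [Real.pi_lt_d4]
        linarith
      rw [one_div_div]
      linarith
    calc p / (Real.pi * t) * (1 / Real.sin (Real.pi / p))
        ≤ p / (Real.pi * t) * (1.004 * (p / Real.pi)) := by gcongr
      _ = _ := by field_simp
  have hsplit : ∑ j ∈ range h, B j = ∑ j ∈ range t, B j + ∑ j ∈ range (h - t), B (t + j) := by
    rw [← sum_range_add, Nat.add_sub_cancel' hth]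
  rw [hsplit] at hmain
  have hdiv : ‖∑ m ∈ range n, χ (m : ZMod p)‖ ≤
      (2 / √p * ((2 * l + 1) * (p / (Real.pi * √2) * (15 / 8 + Real.log t)
      + Real.pi * t * (t + 1) / (4 * p)) + 1.004 * p ^ 2 / (Real.pi ^ 2 * t))
        + 2 * l * (l + 1)) / (2 * l + 1) := by
    rw [le_div_iff₀' hl]
    refine hmain.trans ?_
    gcongr
  refine hdiv.trans ?_
  rw [div_le_iff₀ hl]
  have e : 2 / √p * (p / (Real.pi * √2) * (15 / 8 + Real.log t)
          + Real.pi * t * (t + 1) / (4 * p)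
          + 1.004 * p ^ 2 / (Real.pi ^ 2 * (t * (2 * l + 1)))) * (2 * l + 1)
      = 2 / √p * ((2 * l + 1) * (p / (Real.pi * √2) * (15 / 8 + Real.log t)
      + Real.pi * t * (t + 1) / (4 * p)) + 1.004 * p ^ 2 / (Real.pi ^ 2 * t)) := by
    field_simp
  rw [add_mul _ ((2 * l + 1 : ℝ) / 2), e]
  -- What remains is `2l(l + 1) ≤ (2l + 1)² / 2`.
  nlinarith

end SquarefreePrimitiveRoot

/-! ### The explicit Pólya–Vinogradov inequality -/

namespace SquarefreePrimitiveRoot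
open Finset

lemma sum_range_mulChar_eq_zero {p : ℕ} [Fact p.Prime] {χ : MulChar (ZMod p) ℂ} (hχ : χ ≠ 1)
    (k : ℕ) : ∑ m ∈ range p, χ ((k + m : ℕ) : ZMod p) = 0 := by
  rw [← MulChar.sum_eq_zero_of_ne_one hχ]
  refine (sum_nbij' (fun m : ℕ => ((k + m : ℕ) : ZMod p)) (fun a => (a - (k : ZMod p)).val) ?_ ?_ ?_ ?_ ?_)
  · simp
  · intro a _; simpa using ZMod.val_lt (a - (k : ZMod p))
  · intro m hm
    simp [ZMod.val_cast_of_lt (mem_range.mp hm)]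
  · intro a _; simp
  · simp

/-- Sums over full periods vanish, so `n` reduces to a residue `r`; the sum is then at most `r - 1`
directly (as `χ 0 = 0`) and at most `p - r` through the complement. -/
lemma norm_sum_mulChar_range_le_half {p : ℕ} [Fact p.Prime] {χ : MulChar (ZMod p) ℂ}
    (hχ : χ ≠ 1) (n : ℕ) : ‖∑ m ∈ range n, χ (m : ZMod p)‖ ≤ ((p : ℝ) - 1) / 2 := by
  have hp := (Fact.out : p.Prime)
  have hmod : ∀ q r : ℕ, ∑ m ∈ range (r + p * q), χ (m : ZMod p)
      = ∑ m ∈ range r, χ (m : ZMod p) := by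
    intro q r
    induction q with
    | zero => simp
    | succ q ih =>
      rw [mul_add, mul_one, ← add_assoc, sum_range_add, ih, sum_range_mulChar_eq_zero hχ, add_zero]
  rw [← Nat.mod_add_div n p, hmod]
  have hr := Nat.mod_lt n hp.pos
  generalize n % p = r at hr
  have h1 : ‖∑ m ∈ range r, χ (m : ZMod p)‖ ≤ (r - 1 : ℕ) := by
    rcases r with - | r
    · simp
    · rw [sum_range_succ']
      simp only [Nat.cast_zero, MulChar.map_nonunit χ not_isUnit_zero, add_zero]
      simpa using norm_sum_le_of_le (range r) (f := fun m : ℕ => χ ((m + 1 : ℕ) : ZMod p))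
        fun m _ => norm_mulChar_le_one χ _
  have h2 : ‖∑ m ∈ range r, χ (m : ZMod p)‖ ≤ (p - r : ℕ) := by
    have e := sum_range_mulChar_eq_zero hχ 0
    simp only [zero_add] at e
    have hpr : range p = range (r + (p - r)) := by congr 1; omega
    rw [hpr, sum_range_add] at e
    rw [eq_neg_of_add_eq_zero_left e, norm_neg]
    simpa using norm_sum_le_of_le (range (p - r)) (f := fun m : ℕ => χ ((r + m : ℕ) : ZMod p))
        fun m _ => norm_mulChar_le_one χ _
  have h3 : (r - 1 : ℕ) + (p - r : ℕ) ≤ p - 1 ∨ r = 0 := by omega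
  rcases h3 with h3 | rfl
  · have h4 : ((r - 1 : ℕ) : ℝ) + ((p - r : ℕ) : ℝ) ≤ p - 1 := by
      rw [← Nat.cast_pred hp.pos]; exact_mod_cast h3
    linarith
  · have : (1 : ℝ) ≤ p := by exact_mod_cast hp.one_le
    simp; linarith

lemma one_div_pi_mul_sqrt_two_ge : 0.225 ≤ 1 / (Real.pi * √2) := by
  have hs2 : (√2 : ℝ) ≤ 1.41422 := by
    rw [Real.sqrt_le_left (by norm_num)]; norm_num
  rw [le_div_iff₀ (by positivity)]
  nlinarith [Real.pi_pos, Real.pi_lt_d4]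

/-- The constant is just below `log 4 - 4/6.08`, and `6.08` is just below `√37`. -/
lemma log_le_log_sub_of_lt {r t : ℝ} (hr0 : 6.08 ≤ r) (ht0 : 0 < t) (ht2 : t < r / 4 + 1) :
    Real.log t ≤ Real.log r - 0.7282 := by
  have h1 : Real.log t ≤ Real.log (r / 4 + 1) := Real.log_le_log ht0 ht2.le
  have h2 : Real.log (r / 4 + 1) = Real.log r + Real.log (1 + 4 / r) - Real.log 4 := by
    rw [← Real.log_mul (by linarith) (by positivity), ← Real.log_div (by positivity) (by norm_num)]
    congr 1
    field_simp
  have h3 : Real.log (1 + 4 / r) ≤ 4 / r := by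
    have := Real.log_le_sub_one_of_pos (show 0 < 1 + 4 / r by positivity)
    linarith
  have h4 : 4 / r ≤ 0.658 := by
    rw [div_le_iff₀ (by linarith)]; linarith
  have h5 : Real.log 4 = 2 * Real.log 2 := by
    rw [show (4 : ℝ) = 2 ^ 2 by norm_num, Real.log_pow]; norm_num
  have := Real.log_two_gt_d9
  linarith

lemma completed_sum_secondary_le {r t l : ℝ} (hr0 : 6.08 ≤ r) (ht1 : r / 4 ≤ t)
    (ht2 : t < r / 4 + 1) (hl2 : r - 1 / 2 < l + 1) :
    Real.pi * t * (t + 1) / (4 * r ^ 2)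
      + 1.004 * (r ^ 2) ^ 2 / (Real.pi ^ 2 * (t * (2 * l + 1))) ≤ 0.2495 * r ^ 2 := by
  have hpi := Real.pi_lt_d4
  have hpi' := Real.pi_gt_d4
  have hsmall : Real.pi * t * (t + 1) / (4 * r ^ 2) ≤ 0.0055 * r ^ 2 := by
    rw [div_le_iff₀ (by positivity)]
    have h3 : t * (t + 1) ≤ 0.4146 * r * (0.5791 * r) := by
      gcongr <;> linarith
    have h4 : 36.96 ≤ r ^ 2 := by nlinarith
    nlinarith
  have htail : 1.004 * (r ^ 2) ^ 2 / (Real.pi ^ 2 * (t * (2 * l + 1))) ≤ 0.244 * r ^ 2 := by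
    have h1 : r / 4 * (2 * r - 2) ≤ t * (2 * l + 1) :=
      mul_le_mul ht1 (by linarith) (by linarith) (by linarith)
    have h2 : 0.4177 * r ^ 2 ≤ t * (2 * l + 1) := by nlinarith
    have h3 : 9.869 ≤ Real.pi ^ 2 := by nlinarith
    have h4 : 9.869 * (0.4177 * r ^ 2) ≤ Real.pi ^ 2 * (t * (2 * l + 1)) := by gcongr
    rw [div_le_iff₀ (lt_of_lt_of_le (by positivity) h4)]
    nlinarith [sq_nonneg r]
  linarith

lemma norm_sum_mulChar_range_le_of_large {p : ℕ} [Fact p.Prime] (hp37 : 37 ≤ p)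
    {χ : MulChar (ZMod p) ℂ} (hχ : χ ≠ 1) (n : ℕ) :
    ‖∑ m ∈ range n, χ (m : ZMod p)‖
      ≤ √p * ((Real.log p + 5) / (Real.pi * √2) + 1) := by
  obtain ⟨h, hh⟩ : ∃ h, p = 2 * h + 1 :=
    (Fact.out : p.Prime).odd_of_ne_two (by omega)
  have hp37' : (37 : ℝ) ≤ p := by exact_mod_cast hp37
  set r := √(p : ℝ) with hr
  have hr2 : r ^ 2 = p := Real.sq_sqrt (by positivity)
  have hr0 : 6.08 ≤ r := Real.le_sqrt_of_sq_le (by norm_num; linarith)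
  clear_value r
  -- The cut is near `√p / 4`. The smoothing length `l` is the largest with `(2l + 1)/2 ≤ √p`, so
  -- smoothing costs exactly the summand `1` in the bound.
  obtain ⟨t, ht1, ht2⟩ : ∃ t : ℕ, r / 4 ≤ t ∧ (t : ℝ) < r / 4 + 1 :=
    ⟨⌈r / 4⌉₊, Nat.le_ceil _, Nat.ceil_lt_add_one (by linarith)⟩
  obtain ⟨l, hl1, hl2⟩ : ∃ l : ℕ, (l : ℝ) ≤ r - 1 / 2 ∧ r - 1 / 2 < l + 1 :=
    ⟨⌊r - 1 / 2⌋₊, Nat.floor_le (by linarith), Nat.lt_floor_add_one _⟩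
  have hpi := Real.pi_lt_d4
  have ht0 : (0 : ℝ) < t := by linarith
  have ht : 1 ≤ t := by exact_mod_cast ht0
  have hth : t ≤ h := by
    have e : (2 * h + 1 : ℝ) = r ^ 2 := by rw [hr2, hh]; push_cast; rfl
    have : (t : ℝ) ≤ h := by nlinarith
    exact_mod_cast this
  have htp : Real.pi * t ≤ p := by rw [← hr2]; nlinarith
  refine (norm_sum_mulChar_range_le_split hh hp37 hχ n l t ht hth htp).trans ?_
  rw [← hr, ← hr2]
  have hlog := log_le_log_sub_of_lt hr0 ht0 ht2
  have hsec := completed_sum_secondary_le hr0 ht1 ht2 hl2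
  have hU := one_div_pi_mul_sqrt_two_ge
  rw [Real.log_pow, div_eq_mul_one_div (r ^ 2), div_eq_mul_one_div (_ + 5)]
  push_cast
  generalize 1 / (Real.pi * √2) = U at hU ⊢
  have e1 : 2 / r * (r ^ 2 * U * (15 / 8 + Real.log t)
      + Real.pi * t * (t + 1) / (4 * r ^ 2)
      + 1.004 * (r ^ 2) ^ 2 / (Real.pi ^ 2 * (t * (2 * l + 1))))
      ≤ 2 / r * (r ^ 2 * U * (15 / 8 + (Real.log r - 0.7282)) + 0.2495 * r ^ 2) := by
    rw [add_assoc]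
    refine mul_le_mul_of_nonneg_left (add_le_add
      (mul_le_mul_of_nonneg_left ?_ ?_) hsec) ?_
    · linarith
    · positivity
    · exact div_nonneg two_pos.le (by linarith)
  have e2 : 2 / r * (r ^ 2 * U * (15 / 8 + (Real.log r - 0.7282)) + 0.2495 * r ^ 2)
      = r * (2 * U * (15 / 8 + (Real.log r - 0.7282)) + 0.499) := by
    have : r ≠ 0 := by linarith
    field_simp; ring
  -- The coefficient 5 suffices because `(5 - 2 (15/8 - 0.7282)) U ≥ 0.499` once `U ≥ 0.225`.
  have e3 : r * (2 * U * (15 / 8 + (Real.log r - 0.7282)) + 0.499)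
      ≤ r * ((2 * Real.log r + 5) * U) :=
    mul_le_mul_of_nonneg_left (by nlinarith) (by linarith)
  linarith

/-- An explicit Pólya–Vinogradov inequality for initial intervals. -/
theorem polya_vinogradov {p : ℕ} [Fact p.Prime] {χ : MulChar (ZMod p) ℂ} (hχ : χ ≠ 1) (n : ℕ) :
    ‖∑ m ∈ range n, χ (m : ZMod p)‖
      ≤ √p * ((Real.log p + 5) / (Real.pi * √2) + 1) := by
  -- For `p ≤ 31` the trivial bound `(p - 1)/2` is already smaller; the ranges up to 16 and above 16
  -- are estimated separately.
  by_cases hp37 : 37 ≤ p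
  · exact norm_sum_mulChar_range_le_of_large hp37 hχ n
  have hp := (Fact.out : p.Prime)
  have hp31 : p ≤ 31 := by
    by_contra hcon
    have : p = 32 ∨ p = 33 ∨ p = 34 ∨ p = 35 ∨ p = 36 := by omega
    rcases this with h | h | h | h | h <;> · rw [h] at hp; norm_num at hp
  refine (norm_sum_mulChar_range_le_half hχ n).trans ?_
  have hp2 : (2 : ℝ) ≤ p := by exact_mod_cast hp.two_le
  have hp31' : (p : ℝ) ≤ 31 := by exact_mod_cast hp31
  have hU := one_div_pi_mul_sqrt_two_ge
  rw [div_eq_mul_one_div (Real.log p + 5)]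
  generalize 1 / (Real.pi * √2) = U at hU ⊢
  set r := √(p : ℝ) with hr
  have hr2 : r ^ 2 = p := Real.sq_sqrt (by positivity)
  have hr0 : 0 ≤ r := Real.sqrt_nonneg _
  by_cases h16 : p ≤ 16
  · have h16' : (p : ℝ) ≤ 16 := by exact_mod_cast h16
    have hlog : 0 ≤ Real.log p := Real.log_nonneg (by linarith)
    have h1 : 5 * 0.225 ≤ (Real.log p + 5) * U := by nlinarith
    have : r ≤ 4 := by nlinarith
    nlinarith
  · have h16' : (16 : ℝ) ≤ p := by exact_mod_cast (by omega : 16 ≤ p)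
    have hlog : 2.77 ≤ Real.log p := by
      have h1 : Real.log 16 ≤ Real.log p := Real.log_le_log (by norm_num) h16'
      have h5 : Real.log 16 = 4 * Real.log 2 := by
        rw [show (16 : ℝ) = 2 ^ 4 by norm_num, Real.log_pow]; norm_num
      have := Real.log_two_gt_d9
      linarith
    have h1 : 7.77 * 0.225 ≤ (Real.log p + 5) * U := by nlinarith
    have : r ≤ 5.57 := by nlinarith
    nlinarith

end SquarefreePrimitiveRoot

/-! ### Möbius sums over square divisors and the Mertens function -/

namespace SquarefreePrimitiveRoot
open Finset

lemma sum_Ioc_ite_dvd {R : Type*} [AddCommMonoid R] {e : ℕ} (he : 0 < e) (N : ℕ) (f : ℕ → R) :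
    ∑ n ∈ Ioc 0 N, (if e ∣ n then f n else 0) = ∑ m ∈ Ioc 0 (N / e), f (e * m) := by
  rw [← sum_filter]
  refine sum_nbij' (fun n => n / e) (fun m => e * m) ?_ ?_ ?_ ?_ ?_
  · intro n hn
    simp only [mem_filter, mem_Ioc] at hn ⊢
    exact ⟨Nat.div_pos (Nat.le_of_dvd hn.1.1 hn.2) he, Nat.div_le_div_right hn.1.2⟩
  · intro m hm
    simp only [mem_filter, mem_Ioc] at hm ⊢
    exact ⟨⟨Nat.mul_pos he hm.1, by rw [mul_comm]; exact (Nat.le_div_iff_mul_le he).mp hm.2⟩,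
      dvd_mul_right _ _⟩
  · intro n hn
    exact Nat.mul_div_cancel' (mem_filter.mp hn).2
  · intro m _
    exact Nat.mul_div_cancel_left m he
  · intro n hn
    rw [Nat.mul_div_cancel' (mem_filter.mp hn).2]

lemma sum_moebius_divisors (n : ℕ) :
    ∑ d ∈ n.divisors, ArithmeticFunction.moebius d = if n = 1 then 1 else 0 := by
  rw [← ArithmeticFunction.coe_mul_zeta_apply, ArithmeticFunction.moebius_mul_coe_zeta,
    ArithmeticFunction.one_apply]

/-- With `n = b² a` and `a` square-free, `d² ∣ n` means `d ∣ b`. The sum is therefore that of `μ`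
over the divisors of `b`, and `b ≤ Y` makes the cutoff harmless. -/
lemma sum_moebius_sq_dvd {n Y : ℕ} (hn : 0 < n) (hY : n < (Y + 1) ^ 2) :
    ∑ d ∈ Ioc 0 Y, (if d ^ 2 ∣ n then ArithmeticFunction.moebius d else 0)
      = if Squarefree n then 1 else 0 := by
  obtain ⟨a, b, ha, hb, hab, hsq⟩ := Nat.sq_mul_squarefree_of_pos hn
  have hbY : b ≤ Y := by
    have : b ^ 2 < (Y + 1) ^ 2 :=
      lt_of_le_of_lt (Nat.le_of_dvd hn (hab ▸ dvd_mul_right _ _)) hY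
    exact Nat.lt_succ_iff.mp (lt_of_pow_lt_pow_left₀ 2 (by omega) this)
  have hdvd (d : ℕ) : d ^ 2 ∣ n ↔ d ∣ b := by
    constructor
    · intro h
      have h2 : d * d ∣ a * (b * b) := by rw [← sq, ← sq, mul_comm, hab]; exact h
      have h3 : d ^ 2 ∣ b ^ 2 * a := by rw [hab]; exact h
      by_contra hnd
      have hg : 0 < Nat.gcd d b := Nat.gcd_pos_of_pos_right _ hb
      obtain ⟨g, d', b', hg0, hcop, rfl, rfl⟩ := Nat.exists_coprime' hg
      rw [mul_pow, mul_pow, mul_right_comm] at h3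
      have h4 := (Nat.mul_dvd_mul_iff_right (by positivity)).mp h3
      have h5 := (Nat.Coprime.pow 2 2 hcop).dvd_of_dvd_mul_left h4
      have h6 := Nat.isUnit_iff.mp (hsq d' (by rwa [← sq]))
      exact hnd (by rw [h6, one_mul]; exact dvd_mul_left _ _)
    · intro h
      rw [← hab]
      exact (pow_dvd_pow_of_dvd h 2).mul_right a
  have hset : (Ioc 0 Y).filter (fun d => d ^ 2 ∣ n) = b.divisors := by
    ext d
    simp only [mem_filter, mem_Ioc, Nat.mem_divisors, hdvd]
    constructor
    · rintro ⟨_, h⟩; exact ⟨h, hb.ne'⟩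
    · rintro ⟨h, _⟩
      exact ⟨⟨Nat.pos_of_dvd_of_pos h hb, (Nat.le_of_dvd hb h).trans hbY⟩, h⟩
  rw [← sum_filter, hset, sum_moebius_divisors]
  congr 1
  rw [eq_iff_iff]
  constructor
  · rintro rfl; rw [← hab]; simpa using hsq
  · intro h
    exact Nat.isUnit_iff.mp (h b (by rw [← hab, ← sq]; exact dvd_mul_right _ _))

/-- Sums over square-free integers, opened up with the Möbius function. -/
lemma sum_squarefree_eq {R : Type*} [CommRing R] {N Y : ℕ} (hY : N < (Y + 1) ^ 2) (f : ℕ → R) :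
    ∑ n ∈ Ioc 0 N, (if Squarefree n then f n else 0)
      = ∑ d ∈ Ioc 0 Y, (ArithmeticFunction.moebius d : R)
          * ∑ m ∈ Ioc 0 (N / d ^ 2), f (d ^ 2 * m) := by
  have h1 : ∀ n ∈ Ioc 0 N, (if Squarefree n then f n else 0)
      = ∑ d ∈ Ioc 0 Y,
        (ArithmeticFunction.moebius d : R) * (if d ^ 2 ∣ n then f n else 0) := by
    intro n hn
    rw [mem_Ioc] at hn
    have h := congrArg (fun z : ℤ => (z : R) * f n)
      (sum_moebius_sq_dvd hn.1 (lt_of_le_of_lt hn.2 hY))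
    simp only [Int.cast_sum, Int.cast_ite, Int.cast_zero, Int.cast_one, sum_mul, ite_mul, zero_mul,
      one_mul] at h
    rw [← h]
    exact sum_congr rfl fun d _ => by split_ifs <;> simp
  rw [sum_congr rfl h1, sum_comm]
  refine sum_congr rfl fun d hd => ?_
  rw [← mul_sum, sum_Ioc_ite_dvd (pow_pos (mem_Ioc.mp hd).1 2)]

/-- The number of square-free integers up to `n`. -/
def sqfreeCount (n : ℕ) : ℕ := #{k ∈ Ioc 0 n | Squarefree k}

/-- The Mertens function. -/
def mertens (n : ℕ) : ℤ := ∑ k ∈ Ioc 0 n, ArithmeticFunction.moebius k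

lemma sqfreeCount_succ (n : ℕ) :
    sqfreeCount (n + 1) = sqfreeCount n + if Squarefree (n + 1) then 1 else 0 := by
  rw [sqfreeCount, sqfreeCount, card_filter, card_filter, sum_Ioc_succ_top (Nat.zero_le n)]

lemma not_squarefree_of_sq_dvd {n d : ℕ} (hd : d ≠ 1) (h : d * d ∣ n) : ¬ Squarefree n :=
  fun hs => hd (Nat.isUnit_iff.mp (hs d h))

/-- Only divisibility by 4 and 9 is excluded, which gives density `1 - 1/4 - 1/9 + 1/36 = 2/3`. -/
lemma sqfreeCount_le_sieve (n : ℕ) : sqfreeCount n + n / 4 + n / 9 ≤ n + n / 36 := by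
  induction n with
  | zero => simp [sqfreeCount]
  | succ n ih =>
    rw [sqfreeCount_succ]
    split_ifs with h
    · have h4 : ¬ 4 ∣ n + 1 := fun hd => not_squarefree_of_sq_dvd (d := 2) (by omega) hd h
      have h9 : ¬ 9 ∣ n + 1 := fun hd => not_squarefree_of_sq_dvd (d := 3) (by omega) hd h
      omega
    · omega

lemma three_mul_sqfreeCount_le (n : ℕ) : 3 * sqfreeCount n ≤ 2 * n + 4 := by
  have := sqfreeCount_le_sieve n
  omega

lemma sum_moebius_mul_div {N N' : ℕ} (hN : 1 ≤ N) (h : N ≤ N') :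
    ∑ n ∈ Ioc 0 N', ArithmeticFunction.moebius n * ((N / n : ℕ) : ℤ) = 1 := by
  have h1 : ∀ n ∈ Ioc 0 N', ArithmeticFunction.moebius n * ((N / n : ℕ) : ℤ)
      = ∑ m ∈ Ioc 0 N, if n ∣ m then ArithmeticFunction.moebius n else 0 := by
    intro n hn
    rw [sum_Ioc_ite_dvd (mem_Ioc.mp hn).1]
    simp [mul_comm]
  rw [sum_congr rfl h1, sum_comm]
  have h2 : ∀ m ∈ Ioc 0 N, ∑ n ∈ Ioc 0 N', (if n ∣ m then ArithmeticFunction.moebius n else 0)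
      = if m = 1 then 1 else 0 := by
    intro m hm
    rw [mem_Ioc] at hm
    rw [← sum_moebius_divisors, ← sum_filter]
    congr 1
    ext d
    simp only [mem_filter, mem_Ioc, Nat.mem_divisors]
    constructor
    · rintro ⟨_, h⟩; exact ⟨h, by omega⟩
    · rintro ⟨hd, _⟩
      exact ⟨⟨Nat.pos_of_dvd_of_pos hd hm.1, (Nat.le_of_dvd hm.1 hd).trans (by omega)⟩, hd⟩
  rw [sum_congr rfl h2, sum_ite_eq']
  simp [hN]

/-- Chebyshev's combination `⌊y⌋ - ⌊y/2⌋ - ⌊y/3⌋ - ⌊y/5⌋ + ⌊y/30⌋` takes only the values 0 and 1,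
and equals 1 for `1 ≤ y < 6`. Weighted by `μ` at `y = N/n` its terms sum to `1 - 1 - 1 - 1 + 1 =
-1`, so its defect from 1 sums to `M(N) + 1` and lives on `n ≤ N/6`. -/
lemma abs_mertens_add_one_le {N : ℕ} (hN : 30 ≤ N) : |mertens N + 1| ≤ sqfreeCount (N / 6) := by
  have e : mertens N + 1 = ∑ n ∈ Ioc 0 N, ArithmeticFunction.moebius n
      * (1 - ((N / n : ℕ) - (N / 2 / n : ℕ) - (N / 3 / n : ℕ) - (N / 5 / n : ℕ)
        + (N / 30 / n : ℕ))) := by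
    simp only [mul_sub, mul_add, sum_sub_distrib, sum_add_distrib, mul_one]
    rw [sum_moebius_mul_div (by omega) le_rfl, sum_moebius_mul_div (by omega) (by omega),
      sum_moebius_mul_div (by omega) (by omega), sum_moebius_mul_div (by omega) (by omega),
      sum_moebius_mul_div (by omega) (by omega), mertens]
    ring
  rw [e, sqfreeCount, card_filter, Nat.cast_sum]
  have hsub : Ioc 0 (N / 6) ⊆ Ioc 0 N := Ioc_subset_Ioc_right (Nat.div_le_self _ _)
  rw [← sum_subset hsub]
  · refine (abs_sum_le_sum_abs _ _).trans (sum_le_sum fun n _ => ?_)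
    rw [abs_mul, ArithmeticFunction.abs_moebius]
    split_ifs
    · rw [one_mul]
      rw [Nat.div_right_comm N 2, Nat.div_right_comm N 3, Nat.div_right_comm N 5,
        Nat.div_right_comm N 30]
      generalize N / n = y
      rw [abs_le]
      push_cast
      omega
    · simp
  · intro n hn hn6
    rw [mem_Ioc] at hn hn6
    have hlt : N / n < 6 := by
      rw [Nat.div_lt_iff_lt_mul hn.1]
      omega
    have h1 : 1 ≤ N / n := Nat.div_pos hn.2 hn.1
    rw [Nat.div_right_comm N 2, Nat.div_right_comm N 3, Nat.div_right_comm N 5,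
        Nat.div_right_comm N 30]
    generalize N / n = y at hlt h1
    interval_cases y <;> norm_num

lemma abs_mertens_le {N : ℕ} (hN : 30 ≤ N) : |(mertens N : ℝ)| ≤ N / 9 + 7 / 3 := by
  have h1 := abs_mertens_add_one_le hN
  have h2 := three_mul_sqfreeCount_le (N / 6)
  have h3 : |(mertens N : ℤ)| * 9 ≤ N + 21 := by
    rw [abs_le] at h1
    rcases abs_cases (mertens N) with h | h <;> omega
  have h4 : |(mertens N : ℝ)| * 9 ≤ N + 21 := by exact_mod_cast h3
  linarith

end SquarefreePrimitiveRoot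

/-! ### The count of square-free integers for `x ≥ 4225` -/

namespace SquarefreePrimitiveRoot
open Finset

lemma hasSum_moebius_div_sq :
    HasSum (fun n : ℕ => (ArithmeticFunction.moebius n : ℝ) / (n : ℝ) ^ 2) (6 / Real.pi ^ 2) := by
  have h2 : (1 : ℝ) < (2 : ℂ).re := by norm_num
  have hs : LSeriesHasSum (fun n => (ArithmeticFunction.moebius n : ℂ)) 2 (6 / Real.pi ^ 2) := by
    have h1 := LSeries_one_mul_Lseries_moebius h2
    rw [LSeries_one_eq_riemannZeta h2, riemannZeta_two] at h1
    have h3 := (ArithmeticFunction.LSeriesSummable_moebius_iff.mpr h2).LSeriesHasSum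
    convert h3 using 1
    have hpi : (Real.pi : ℂ) ≠ 0 := by exact_mod_cast Real.pi_ne_zero
    rw [eq_comm, ← mul_right_inj' (show (Real.pi : ℂ) ^ 2 / 6 ≠ 0 by simp), h1]
    field_simp
  rw [← Complex.hasSum_ofReal]
  push_cast
  refine hs.congr_fun ?_
  intro n
  rcases eq_or_ne n 0 with rfl | hn
  · simp
  · rw [LSeries.term_of_ne_zero hn]
    congr 1
    norm_cast

lemma mertens_succ (n : ℕ) :
    mertens (n + 1) = mertens n + ArithmeticFunction.moebius (n + 1) := by
  rw [mertens, mertens, sum_Ioc_succ_top (Nat.zero_le n)]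

/-- Partial summation against the Mertens function. The boundary term at `n₀` stays on the left
because it is later combined with another multiple of `mertens n₀`. Induction on `m` needs the
sharper telescoping form `key`. -/
lemma abs_sum_moebius_div_sq_add_le {ε C : ℝ} (hε : 0 ≤ ε) {n₀ : ℕ} (hn₀ : 0 < n₀)
    (hM : ∀ n, n₀ ≤ n → |(mertens n : ℝ)| ≤ ε * n + C) {m : ℕ} (hm : n₀ ≤ m) :
    |∑ d ∈ Ioc n₀ m, (ArithmeticFunction.moebius d : ℝ) / (d : ℝ) ^ 2
        + mertens n₀ / (n₀ + 1 : ℝ) ^ 2|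
      ≤ (ε * n₀ + C) / (n₀ + 1 : ℝ) ^ 2 + ε / n₀ := by
  have key : |∑ d ∈ Ioc n₀ m, (ArithmeticFunction.moebius d : ℝ) / (d : ℝ) ^ 2
        + mertens n₀ / (n₀ + 1 : ℝ) ^ 2 - mertens m / (m + 1 : ℝ) ^ 2|
      ≤ (ε * n₀ + C) / (n₀ + 1 : ℝ) ^ 2 - (ε * m + C) / (m + 1 : ℝ) ^ 2 + ε * (1 / n₀ - 1 / m) := by
    induction m, hm using Nat.le_induction with
    | base => simp
    | succ m hm ih =>
      rw [sum_Ioc_succ_top hm]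
      have hm0 : (0 : ℝ) < m := by exact_mod_cast hn₀.trans_le hm
      have e1 : ∑ d ∈ Ioc n₀ m, (ArithmeticFunction.moebius d : ℝ) / (d : ℝ) ^ 2
          + (ArithmeticFunction.moebius (m + 1) : ℝ) / ((m + 1 : ℕ) : ℝ) ^ 2
          + mertens n₀ / (n₀ + 1 : ℝ) ^ 2 - mertens (m + 1) / (((m + 1 : ℕ) : ℝ) + 1) ^ 2
          = (∑ d ∈ Ioc n₀ m, (ArithmeticFunction.moebius d : ℝ) / (d : ℝ) ^ 2
            + mertens n₀ / (n₀ + 1 : ℝ) ^ 2 - mertens m / (m + 1 : ℝ) ^ 2)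
            + mertens (m + 1) * (1 / (m + 1 : ℝ) ^ 2 - 1 / (m + 1 + 1 : ℝ) ^ 2) := by
        rw [mertens_succ]; push_cast; ring
      have hpos : 0 ≤ 1 / (m + 1 : ℝ) ^ 2 - 1 / (m + 1 + 1 : ℝ) ^ 2 := by
        rw [sub_nonneg]; gcongr; linarith
      have h2 := mul_le_mul_of_nonneg_right (hM (m + 1) (by omega)) hpos
      rw [e1]
      refine (abs_add_le _ _).trans ?_
      rw [abs_mul, abs_of_nonneg hpos]
      have h3 : ε / (m + 1 : ℝ) ^ 2 ≤ ε * (1 / m - 1 / (m + 1)) := by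
        rw [div_eq_mul_one_div]
        refine mul_le_mul_of_nonneg_left ?_ hε
        rw [div_sub_div _ _ hm0.ne' (by positivity), div_le_div_iff₀ (by positivity) (by positivity)]
        nlinarith
      have h4 : (ε * m + C) / (m + 1 : ℝ) ^ 2 + ε / (m + 1 : ℝ) ^ 2
          = (ε * (m + 1) + C) * (1 / (m + 1 : ℝ) ^ 2) := by field_simp; ring
      have h5 : (ε * (m + 1) + C) / (m + 1 + 1 : ℝ) ^ 2
          = (ε * (m + 1) + C) * (1 / (m + 1 + 1 : ℝ) ^ 2) := by field_simp
      push_cast at h2 ⊢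
      rw [h5]
      linarith
  have hm' := hM m hm
  have h1 : |(mertens m : ℝ) / (m + 1 : ℝ) ^ 2| ≤ (ε * m + C) / (m + 1 : ℝ) ^ 2 := by
    rw [abs_div, abs_of_pos (show (0 : ℝ) < (m + 1 : ℝ) ^ 2 by positivity)]
    gcongr
  have h2 : 0 ≤ ε * (1 / m : ℝ) := by positivity
  have h3 := abs_add_le (∑ d ∈ Ioc n₀ m, (ArithmeticFunction.moebius d : ℝ) / (d : ℝ) ^ 2
        + mertens n₀ / (n₀ + 1 : ℝ) ^ 2 - mertens m / (m + 1 : ℝ) ^ 2)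
        ((mertens m : ℝ) / (m + 1 : ℝ) ^ 2)
  rw [sub_add_cancel] at h3
  rw [div_eq_mul_one_div ε]
  linarith

lemma abs_tail_moebius_div_sq_le {ε C : ℝ} (hε : 0 ≤ ε) {n₀ : ℕ} (hn₀ : 0 < n₀)
    (hM : ∀ n, n₀ ≤ n → |(mertens n : ℝ)| ≤ ε * n + C) :
    |6 / Real.pi ^ 2 - ∑ d ∈ Ioc 0 n₀, (ArithmeticFunction.moebius d : ℝ) / (d : ℝ) ^ 2
        + mertens n₀ / (n₀ + 1 : ℝ) ^ 2|
      ≤ (ε * n₀ + C) / (n₀ + 1 : ℝ) ^ 2 + ε / n₀ := by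
  have h1 := hasSum_moebius_div_sq.tendsto_sum_nat
  have h2 := (((h1.comp (Filter.tendsto_add_atTop_nat 1)).sub_const
    (∑ d ∈ Ioc 0 n₀, (ArithmeticFunction.moebius d : ℝ) / (d : ℝ) ^ 2)).add_const
    (mertens n₀ / (n₀ + 1 : ℝ) ^ 2)).abs
  refine le_of_tendsto h2 ?_
  filter_upwards [Filter.eventually_ge_atTop n₀] with m hm
  refine le_trans (le_of_eq ?_) (abs_sum_moebius_div_sq_add_le hε hn₀ hM hm)
  congr 2
  have h3 := sum_Ioc_consecutive
    (fun d : ℕ => (ArithmeticFunction.moebius d : ℝ) / (d : ℝ) ^ 2) (Nat.zero_le n₀) hm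
  have h4 : ∑ d ∈ range (m + 1), (ArithmeticFunction.moebius d : ℝ) / (d : ℝ) ^ 2
      = ∑ d ∈ Ioc 0 m, (ArithmeticFunction.moebius d : ℝ) / (d : ℝ) ^ 2 := by
    rw [range_eq_Ico, sum_eq_sum_Ico_succ_bot (by omega)]
    simp only [CharP.cast_eq_zero, ne_eq, OfNat.ofNat_ne_zero, not_false_eq_true, zero_pow,
      div_zero, zero_add]
    rfl
  simp only [Function.comp]
  rw [h4, ← h3]
  ring

lemma sqfreeCount_eq_sum {n Y : ℕ} (hY : n < (Y + 1) ^ 2) :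
    (sqfreeCount n : ℝ)
      = ∑ d ∈ Ioc 0 Y, (ArithmeticFunction.moebius d : ℝ) * ((n / d ^ 2 : ℕ) : ℝ) := by
  have := sum_squarefree_eq (R := ℝ) hY (fun _ => 1)
  simp only [sum_const, Nat.card_Ioc, nsmul_eq_mul, mul_one, Nat.sub_zero] at this
  rw [← this, sqfreeCount, card_filter]
  push_cast
  rfl

lemma abs_sqfreeCount_sub_le_of_large {x : ℝ} (hx : 4225 ≤ x) :
    |(sqfreeCount ⌊x⌋₊ : ℝ) - 6 / Real.pi ^ 2 * x| ≤ cipuConst * √x := by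
  have hx0 : 0 ≤ x := by linarith
  set y := √x with hy
  have hy2 : y ^ 2 = x := Real.sq_sqrt hx0
  have hy0 : 65 ≤ y := Real.le_sqrt_of_sq_le (by norm_num; linarith)
  set n₀ := ⌊y⌋₊ with hn₀
  have hle : (n₀ : ℝ) ≤ y := Nat.floor_le (by linarith)
  have hlt : y < n₀ + 1 := Nat.lt_floor_add_one y
  have h65 : 65 ≤ n₀ := Nat.le_floor (by simpa using hy0)
  have h65' : (65 : ℝ) ≤ n₀ := by exact_mod_cast h65
  have hxlt : x < (n₀ + 1 : ℝ) ^ 2 := by rw [← hy2]; gcongr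
  have hflt : ⌊x⌋₊ < (n₀ + 1) ^ 2 := (Nat.floor_lt hx0).mpr (by push_cast; exact hxlt)
  have hM : ∀ n, n₀ ≤ n → |(mertens n : ℝ)| ≤ 1 / 9 * n + 7 / 3 := by
    intro n hn
    have := abs_mertens_le (N := n) (by omega)
    linarith
  have htail := abs_tail_moebius_div_sq_le (by norm_num) (by omega) hM
  have hMn := hM n₀ le_rfl
  set S := ∑ d ∈ Ioc 0 n₀, (ArithmeticFunction.moebius d : ℝ) / (d : ℝ) ^ 2 with hS
  set θ := 6 / Real.pi ^ 2 - S + mertens n₀ / (n₀ + 1 : ℝ) ^ 2 with hθ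
  -- Centring each fractional part at `1/2` halves the rounding error, at the price of the term
  -- `mertens n₀ / 2`.
  have hmain : |(sqfreeCount ⌊x⌋₊ : ℝ) - x * S + mertens n₀ / 2| ≤ (n₀ + 2) / 3 := by
    have e : (sqfreeCount ⌊x⌋₊ : ℝ) - x * S + mertens n₀ / 2
        = ∑ d ∈ Ioc 0 n₀, (ArithmeticFunction.moebius d : ℝ)
          * (((⌊x⌋₊ / d ^ 2 : ℕ) : ℝ) - x / (d : ℝ) ^ 2 + 1 / 2) := by
      rw [sqfreeCount_eq_sum hflt, hS, mertens]
      push_cast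
      rw [mul_sum, sum_div, ← sum_sub_distrib, ← sum_add_distrib]
      exact sum_congr rfl fun d _ => by ring
    have hb : ∀ d ∈ Ioc 0 n₀, |(ArithmeticFunction.moebius d : ℝ)
          * (((⌊x⌋₊ / d ^ 2 : ℕ) : ℝ) - x / (d : ℝ) ^ 2 + 1 / 2)|
          ≤ 1 / 2 * if Squarefree d then 1 else 0 := by
      intro d hd
      have hd0 := (mem_Ioc.mp hd).1
      rw [abs_mul, ← Int.cast_abs, ArithmeticFunction.abs_moebius]
      have e2 : ⌊x⌋₊ / d ^ 2 = ⌊x / (d : ℝ) ^ 2⌋₊ := by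
        rw [← Nat.floor_div_natCast]; push_cast; rfl
      split_ifs
      · rw [e2, Int.cast_one, one_mul, mul_one, abs_le]
        have h1 := Nat.floor_le (show 0 ≤ x / (d : ℝ) ^ 2 by positivity)
        have h2 := Nat.lt_floor_add_one (x / (d : ℝ) ^ 2)
        constructor <;> linarith
      · simp
    rw [e]
    refine (abs_sum_le_sum_abs _ _).trans ((sum_le_sum hb).trans ?_)
    rw [← mul_sum]
    have h1 : ∑ d ∈ Ioc 0 n₀, (if Squarefree d then (1 : ℝ) else 0) = sqfreeCount n₀ := by
      rw [sqfreeCount, card_filter]; push_cast; rfl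
    have h2 : (3 : ℝ) * sqfreeCount n₀ ≤ 2 * n₀ + 4 := by
      exact_mod_cast three_mul_sqfreeCount_le n₀
    rw [h1]; linarith
  have hR : (sqfreeCount ⌊x⌋₊ : ℝ) - 6 / Real.pi ^ 2 * x
      = ((sqfreeCount ⌊x⌋₊ : ℝ) - x * S + mertens n₀ / 2)
        + mertens n₀ * (x / (n₀ + 1 : ℝ) ^ 2 - 1 / 2) - x * θ := by
    rw [hθ]; ring
  have h1 : |mertens n₀ * (x / (n₀ + 1 : ℝ) ^ 2 - 1 / 2)| ≤ (1 / 9 * (n₀ : ℝ) + 7 / 3) * (1 / 2) := by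
    rw [abs_mul]
    refine mul_le_mul hMn ?_ (abs_nonneg _) (by positivity)
    have h2 : x / (n₀ + 1 : ℝ) ^ 2 ≤ 1 := by
      rw [div_le_one (by positivity)]; exact hxlt.le
    have h3 : 0 ≤ x / (n₀ + 1 : ℝ) ^ 2 := by positivity
    rw [abs_le]; constructor <;> linarith
  have h2 : |x * θ| ≤ (1 / 9 * (n₀ : ℝ) + 7 / 3) + 1 / 9 * (n₀ + 2 + 1 / 65) := by
    rw [abs_mul, abs_of_nonneg hx0]
    calc x * |θ| ≤ (n₀ + 1 : ℝ) ^ 2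
          * ((1 / 9 * n₀ + 7 / 3) / (n₀ + 1 : ℝ) ^ 2 + 1 / 9 / n₀) :=
          mul_le_mul hxlt.le htail (abs_nonneg _) (by positivity)
      _ = (1 / 9 * n₀ + 7 / 3) + 1 / 9 * (n₀ + 2 + 1 / n₀) := by
          have : (n₀ : ℝ) ≠ 0 := by linarith
          field_simp; ring
      _ ≤ _ := by gcongr
  rw [hR]
  rw [abs_le] at hmain h1 h2 ⊢
  rw [cipuConst]
  -- The coefficients of `n₀` add up to `1/3 + 1/18 + 1/9 + 1/9 = 11/18 < A`; for `√x ≥ 65` the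
  -- margin covers the additive constants, about 4.39.
  constructor <;> linarith

end SquarefreePrimitiveRoot

/-! ### Verified computation of the count for `x < 4225` -/

namespace SquarefreePrimitiveRoot
open Finset

/-- No square of a prime below `67` divides `n`. -/
def sqfreeTest (n : ℕ) : Bool :=
  [4, 9, 25, 49, 121, 169, 289, 361, 529, 841, 961, 1369, 1681, 1849, 2209, 2809, 3481, 3721].all
    fun d => !(n % d).beq 0

/-- The integer form of the bounds on `sqfreeCount n` when it equals `c`. -/
def sqfreeBounds (n c : ℕ) : Bool :=
  ((10000000 * c - 6079271 * n) ^ 2).ble (6790910 ^ 2 * n)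
    && ((6079272 * (n + 1) - 10000000 * c) ^ 2).ble (6790910 ^ 2 * (n + 1))

/-- Check `sqfreeBounds` on `[n, n + 2 ^ k)`, starting from the count `c` at `n`; return the count
at `n + 2 ^ k`. -/
def sqfreeScan : ℕ → ℕ → ℕ → Option ℕ
  | 0, n, c => bif sqfreeBounds n c then some (bif sqfreeTest (n + 1) then c + 1 else c) else none
  | k + 1, n, c => (sqfreeScan k n c).bind (sqfreeScan k (n + 2 ^ k))

lemma squarefree_iff_sqfreeTest {n : ℕ} (hn : n < 4489) (h0 : 0 < n) :
    Squarefree n ↔ sqfreeTest n = true := by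
  have htest : sqfreeTest n = true ↔ ∀ d ∈ [4, 9, 25, 49, 121, 169, 289, 361, 529, 841, 961, 1369,
      1681, 1849, 2209, 2809, 3481, 3721], ¬ d ∣ n := by
    simp only [sqfreeTest, List.all_eq_true, Bool.not_eq_true', Nat.dvd_iff_mod_eq_zero,
      ← Bool.not_eq_true, Nat.beq_eq]
  rw [htest]
  constructor
  · intro h d hd hdvd
    obtain ⟨e, he, rfl⟩ : ∃ e ∈ [2, 3, 5, 7, 11, 13, 17, 19, 23, 29, 31, 37, 41, 43, 47, 53, 59, 61],
        e * e = d := by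
      simp only [List.mem_cons, List.not_mem_nil, or_false] at hd
      rcases hd with rfl | rfl | rfl | rfl | rfl | rfl | rfl | rfl | rfl | rfl | rfl | rfl | rfl |
        rfl | rfl | rfl | rfl | rfl <;> simp
    refine not_squarefree_of_sq_dvd (d := e) ?_ hdvd h
    rintro rfl
    simp at he
  · intro h
    rw [Nat.squarefree_iff_prime_squarefree]
    intro x hx hdvd
    have hlt : x < 67 := by
      have := Nat.le_of_dvd h0 hdvd
      nlinarith
    refine h (x * x) ?_ hdvd
    interval_cases x <;> first | (norm_num at hx; done) | simp

/-- The limit `4489 = 67²` is where testing squares of primes below 67 stops being sufficient.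
Writing `sqfreeCount 0 + c` makes the starting case hold by `rfl`. -/
lemma sqfreeScan_spec (k : ℕ) {n c : ℕ} (hn : n + 2 ^ k < 4489) (h : sqfreeCount n = sqfreeCount 0 + c)
    {c' : ℕ} (hs : sqfreeScan k n c = some c') :
    sqfreeCount (n + 2 ^ k) = c'
      ∧ ∀ m, n ≤ m → m < n + 2 ^ k → sqfreeBounds m (sqfreeCount m) = true := by
  have h00 : sqfreeCount 0 = 0 := by simp [sqfreeCount]
  induction k generalizing n c c' with
  | zero =>
    rw [h00, zero_add] at h
    rw [sqfreeScan] at hs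
    rcases hb : sqfreeBounds n c with - | -
    · simp [hb] at hs
    · simp only [hb, cond_true, Option.some.injEq] at hs
      constructor
      · rw [pow_zero, sqfreeCount_succ, ← hs, h, Bool.cond_eq_ite]
        have := squarefree_iff_sqfreeTest (n := n + 1) (by simpa using hn) (by omega)
        split_ifs <;> simp_all
      · intro m h1 h2
        obtain rfl : m = n := by simp at h2; omega
        rwa [h]
  | succ k ih =>
    rw [sqfreeScan, Option.bind_eq_some_iff] at hs
    obtain ⟨c₁, hc₁, hc'⟩ := hs
    rw [pow_succ, mul_two] at hn ⊢
    have hpos := Nat.two_pow_pos k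
    obtain ⟨i1, i2⟩ := ih (by omega) h hc₁
    obtain ⟨j1, j2⟩ := ih (by omega) (by rw [i1, h00, zero_add]) hc'
    rw [← add_assoc]
    refine ⟨j1, fun m h1 h2 => ?_⟩
    rcases lt_or_ge m (n + 2 ^ k) with hlt | hge
    · exact i2 m h1 hlt
    · exact j2 m hge h2

lemma sqfreeBounds_sqfreeCount {n : ℕ} (hn : n < 4225) :
    sqfreeBounds n (sqfreeCount n) = true := by
  -- Two dyadic blocks, `[0, 4096)` and `[4096, 4352)`, cover the range.
  have h1 : sqfreeScan 12 0 0 = some 2491 := by decide +kernel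
  have h2 : (sqfreeScan 8 4096 2491).isSome = true := by decide +kernel
  obtain ⟨c', hc'⟩ := Option.isSome_iff_exists.mp h2
  have h00 : sqfreeCount 0 = 0 := by simp [sqfreeCount]
  obtain ⟨i1, i2⟩ := sqfreeScan_spec 12 (by norm_num) rfl h1
  obtain ⟨j1, j2⟩ := sqfreeScan_spec 8 (by norm_num) (by rw [h00, zero_add]; exact i1) hc'
  rcases lt_or_ge n 4096 with hlt | hge
  · exact i2 n (by omega) (by simpa using hlt)
  · exact j2 n hge (by norm_num; omega)

lemma six_div_pi_sq_mem : 0.6079271 < 6 / Real.pi ^ 2 ∧ 6 / Real.pi ^ 2 < 0.6079272 := by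
  have h1 := Real.pi_gt_d20
  have h2 := Real.pi_lt_d20
  have hp := Real.pi_pos
  constructor
  · rw [lt_div_iff₀ (by positivity)]; nlinarith
  · rw [div_lt_iff₀ (by positivity)]; nlinarith

lemma le_mul_sqrt_of_sq_le {a b A : ℝ} (hA : 0 ≤ A) (h : a ≤ 0 ∨ a ^ 2 ≤ A ^ 2 * b) :
    a ≤ A * √b := by
  rcases h with h | h
  · exact h.trans (by positivity)
  · have : √(A ^ 2 * b) = A * √b := by
      rw [Real.sqrt_mul (sq_nonneg A), Real.sqrt_sq hA]
    rw [← this]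
    exact Real.le_sqrt_of_sq_le h

/-- Natural subtraction truncates, so the Boolean test is one-sided: a negative difference passes
automatically. -/
lemma nat_sub_sq_le {a b c : ℕ} (h : (a - b) ^ 2 ≤ c) :
    (a : ℝ) - b ≤ 0 ∨ ((a : ℝ) - b) ^ 2 ≤ c := by
  rcases le_total a b with hab | hab
  · left; have : (a : ℝ) ≤ b := by exact_mod_cast hab
    linarith
  · right
    rw [← Nat.cast_sub hab]
    exact_mod_cast h

lemma abs_sqfreeCount_sub_le_of_small {x : ℝ} (hx1 : 1 ≤ x) (hx : x < 4225) :
    |(sqfreeCount ⌊x⌋₊ : ℝ) - 6 / Real.pi ^ 2 * x| ≤ cipuConst * √x := by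
  have hx0 : 0 ≤ x := by linarith
  obtain ⟨p1, p2⟩ := six_div_pi_sq_mem
  generalize 6 / Real.pi ^ 2 = a at p1 p2 ⊢
  have hn : ⌊x⌋₊ < 4225 := (Nat.floor_lt hx0).mpr (by exact_mod_cast hx)
  have hle := Nat.floor_le hx0
  have hlt := Nat.lt_floor_add_one x
  have hb := sqfreeBounds_sqfreeCount hn
  set n := ⌊x⌋₊
  set Q := sqfreeCount n
  rw [sqfreeBounds, Bool.and_eq_true, Nat.ble_eq, Nat.ble_eq] at hb
  obtain ⟨b1, b2⟩ := hb
  have c1 := nat_sub_sq_le b1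
  have c2 := nat_sub_sq_le b2
  push_cast at c1 c2
  have d1 : (10000000 * Q - 6079271 * n : ℝ) ≤ 6790910 * √n := le_mul_sqrt_of_sq_le (by norm_num)
    (by rw [show (6790910 : ℝ) ^ 2 = 46116458628100 by norm_num]; exact c1)
  have d2 : (6079272 * (n + 1) - 10000000 * Q : ℝ) ≤ 6790910 * √(n + 1) :=
    le_mul_sqrt_of_sq_le (by norm_num)
    (by rw [show (6790910 : ℝ) ^ 2 = 46116458628100 by norm_num]; exact c2)
  have s1 : √(n : ℝ) ≤ √x := Real.sqrt_le_sqrt hle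
  have s2 : √x ≤ √(n + 1 : ℝ) := Real.sqrt_le_sqrt hlt.le
  have s3 : √x * √x = x := Real.mul_self_sqrt hx0
  have s4 : √(n + 1 : ℝ) * √(n + 1 : ℝ) = n + 1 := Real.mul_self_sqrt (by positivity)
  have s5 : 1 ≤ √x := Real.one_le_sqrt.mpr hx1
  rw [cipuConst, abs_le]
  constructor
  -- On `[n, n + 1)` the count is constant, so the upper bound is tightest at `n` and the lower
  -- bound at `n + 1`. The latter uses that `a x - A√x` increases for `x ≥ 1`.
  · have : 0.6079272 * x - 0.679091 * √x
        ≤ 0.6079272 * (n + 1 : ℝ) - 0.679091 * √(n + 1 : ℝ) := by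
      nlinarith
    nlinarith
  · nlinarith

/-- The number of square-free integers up to `x` is `6 x / π² + O(√x)`, explicitly. -/
theorem abs_sqfreeCount_sub_le {x : ℝ} (hx : 1 ≤ x) :
    |(sqfreeCount ⌊x⌋₊ : ℝ) - 6 / Real.pi ^ 2 * x| ≤ cipuConst * √x := by
  rcases lt_or_ge x 4225 with h | h
  · exact abs_sqfreeCount_sub_le_of_small hx h
  · exact abs_sqfreeCount_sub_le_of_large h

end SquarefreePrimitiveRoot

/-! ### Character sums over square-free integers -/

namespace SquarefreePrimitiveRoot
open Finset

lemma sum_Icc_indicator_squarefree (n : ℕ) :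
    ∑ k ∈ Icc 0 n, (if Squarefree k then (1 : ℝ) else 0) = sqfreeCount n := by
  rw [Icc_eq_cons_Ioc (Nat.zero_le n), sum_cons, sqfreeCount, card_filter]
  push_cast
  simp

/-- Partial summation for `∑ 1 / d²` over square-free `d`. -/
lemma sum_squarefree_one_div_sq_le {D y : ℝ} (hD : 1 ≤ D) (hDy : D ≤ y) :
    ∑ d ∈ Ioc ⌊D⌋₊ ⌊y⌋₊, (1 / (d : ℝ) ^ 2) * (if Squarefree d then (1 : ℝ) else 0)
      ≤ 6 / Real.pi ^ 2 * (1 / D - 1 / y)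
        + cipuConst * (7 / 3 * (1 / (D * √D)) - 1 / 3 * (1 / (y * √y))) := by
  have hD0 : 0 < D := by linarith
  have hy0 : 0 < y := by linarith
  have hpos : ∀ t ∈ Set.Icc D y, 0 < t := fun t ht => hD0.trans_le ht.1
  have hderiv : ∀ t : ℝ, 0 < t → HasDerivAt (fun t : ℝ => 1 / t ^ 2) (-2 * t ^ (-3 : ℤ)) t := by
    intro t ht
    have := (hasDerivAt_pow 2 t).fun_inv (by positivity)
    simp only [one_div]
    refine this.congr_deriv ?_
    rw [zpow_neg]
    field_simp
    norm_num
    ring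
  have hd' : Set.EqOn (deriv fun t : ℝ => 1 / t ^ 2) (fun t => -2 * t ^ (-3 : ℤ)) (Set.Icc D y) :=
    fun t ht => (hderiv t (hpos t ht)).deriv
  have hcont : ContinuousOn (fun t : ℝ => -2 * t ^ (-3 : ℤ)) (Set.Icc D y) :=
    continuousOn_const.mul (continuousOn_id.zpow₀ _ fun t ht => Or.inl (hpos t ht).ne')
  have hint : MeasureTheory.IntegrableOn (deriv fun t : ℝ => 1 / t ^ 2) (Set.Icc D y) :=
    (hcont.integrableOn_Icc).congr_fun hd'.symm measurableSet_Icc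
  have habel := sum_mul_eq_sub_sub_integral_mul
    (fun k : ℕ => if Squarefree k then (1 : ℝ) else 0) (f := fun t : ℝ => 1 / t ^ 2) hD0.le hDy
    (fun t ht => (hderiv t (hpos t ht)).differentiableAt) hint
  have hint2 := integrableOn_mul_sum_Icc (fun k : ℕ => if Squarefree k then (1 : ℝ) else 0)
    (m := 0) hD0.le hint
  simp only [sum_Icc_indicator_squarefree] at habel hint2
  set a := 6 / Real.pi ^ 2 with ha
  set A := cipuConst with hA
  have hA0 : 0 ≤ A := by rw [hA, cipuConst]; norm_num
  have ha0 : 0 ≤ a := by positivity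
  have h0 : (0 : ℝ) ∉ Set.uIcc D y := by
    rw [Set.uIcc_of_le hDy]; exact fun h => absurd h.1 (by linarith)
  have hi1 : IntervalIntegrable (fun t : ℝ => 2 * a * t ^ (-2 : ℝ)) MeasureTheory.volume D y :=
    (intervalIntegral.intervalIntegrable_rpow (Or.inr h0)).const_mul _
  have hi2 : IntervalIntegrable (fun t : ℝ => 2 * A * t ^ (-5 / 2 : ℝ)) MeasureTheory.volume D y :=
    (intervalIntegral.intervalIntegrable_rpow (Or.inr h0)).const_mul _
  have hI : -∫ t in Set.Ioc D y, deriv (fun t : ℝ => 1 / t ^ 2) t * (sqfreeCount ⌊t⌋₊ : ℝ)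
      ≤ ∫ t in D..y, (2 * a * t ^ (-2 : ℝ) + 2 * A * t ^ (-5 / 2 : ℝ)) := by
    rw [intervalIntegral.integral_of_le hDy, ← MeasureTheory.integral_neg]
    refine MeasureTheory.setIntegral_mono_on ?_ ?_ measurableSet_Ioc ?_
    · exact (hint2.mono_set Set.Ioc_subset_Icc_self).neg
    · exact (hi1.add hi2).1
    · intro t ht
      have htD : t ∈ Set.Icc D y := Set.Ioc_subset_Icc_self ht
      have ht0 := hpos t htD
      rw [hd' htD]
      have hQ := (abs_le.mp (abs_sqfreeCount_sub_le (hD.trans htD.1))).2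
      have e2 : t ^ (-2 : ℝ) = t ^ (-3 : ℤ) * t := by
        rw [← Real.rpow_intCast, ← Real.rpow_add_one ht0.ne']; norm_num
      have e3 : t ^ (-5 / 2 : ℝ) = t ^ (-3 : ℤ) * √t := by
        rw [← Real.rpow_intCast, Real.sqrt_eq_rpow, ← Real.rpow_add ht0]; norm_num
      rw [e2, e3]
      have hz : 0 < t ^ (-3 : ℤ) := by positivity
      have := mul_le_mul_of_nonneg_left
        (show (sqfreeCount ⌊t⌋₊ : ℝ) ≤ a * t + A * √t by linarith) hz.le
      linarith
  have hval : ∫ t in D..y, (2 * a * t ^ (-2 : ℝ) + 2 * A * t ^ (-5 / 2 : ℝ))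
      = 2 * a * (1 / D - 1 / y) + 4 / 3 * A * (1 / (D * √D) - 1 / (y * √y)) := by
    rw [intervalIntegral.integral_add hi1 hi2, intervalIntegral.integral_const_mul,
      intervalIntegral.integral_const_mul, integral_rpow (Or.inr ⟨by norm_num, h0⟩),
      integral_rpow (Or.inr ⟨by norm_num, h0⟩)]
    have e1 (t : ℝ) (ht : 0 < t) : t ^ (-2 + 1 : ℝ) = 1 / t := by
      rw [show (-2 + 1 : ℝ) = -1 by norm_num, Real.rpow_neg_one, one_div]
    have e2 (t : ℝ) (ht : 0 < t) : t ^ (-5 / 2 + 1 : ℝ) = 1 / (t * √t) := by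
      rw [show (-5 / 2 + 1 : ℝ) = -(1 + 1 / 2) by norm_num, Real.rpow_neg ht.le,
        Real.rpow_add ht, Real.rpow_one, ← Real.sqrt_eq_rpow, one_div]
    rw [e1 D hD0, e1 y hy0, e2 D hD0, e2 y hy0]
    ring
  have hb (t : ℝ) (ht : 0 < t) : 1 / t ^ 2 * (a * t + A * √t) = a * (1 / t) + A * (1 / (t * √t)) := by
    have : √t * √t = t := Real.mul_self_sqrt ht.le
    have hs : 0 < √t := Real.sqrt_pos.mpr ht
    field_simp
    linear_combination A * this
  have hb' (t : ℝ) (ht : 0 < t) : 1 / t ^ 2 * (a * t - A * √t) = a * (1 / t) - A * (1 / (t * √t)) := by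
    have : √t * √t = t := Real.mul_self_sqrt ht.le
    have hs : 0 < √t := Real.sqrt_pos.mpr ht
    field_simp
    linear_combination -A * this
  have hQy := (abs_le.mp (abs_sqfreeCount_sub_le (hD.trans hDy))).2
  have hQD := (abs_le.mp (abs_sqfreeCount_sub_le hD)).1
  have hy' := mul_le_mul_of_nonneg_left
    (show (sqfreeCount ⌊y⌋₊ : ℝ) ≤ a * y + A * √y by linarith)
    (show 0 ≤ 1 / y ^ 2 by positivity)
  have hD' := mul_le_mul_of_nonneg_left
    (show a * D - A * √D ≤ (sqfreeCount ⌊D⌋₊ : ℝ) by linarith)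
    (show 0 ≤ 1 / D ^ 2 by positivity)
  rw [hb y hy0] at hy'
  rw [hb' D hD0] at hD'
  rw [habel]
  rw [hval] at hI
  -- The integral contributes `4/3` at both ends of the `A` term; the boundary terms turn this into
  -- `4/3 + 1 = 7/3` at `D` and `4/3 - 1 = 1/3` at `y`.
  linarith

lemma norm_sum_Ioc_mulChar_le {p : ℕ} (χ : MulChar (ZMod p) ℂ) (n : ℕ) :
    ‖∑ m ∈ Ioc 0 n, χ (m : ZMod p)‖ ≤ n := by
  simpa using norm_sum_le_of_le (Ioc 0 n) (f := fun m : ℕ => χ (m : ZMod p))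
    fun m _ => norm_mulChar_le_one χ _

lemma norm_sum_Ioc_mulChar_le_polya {p : ℕ} [Fact p.Prime] {χ : MulChar (ZMod p) ℂ} (hχ : χ ≠ 1)
    (n : ℕ) : ‖∑ m ∈ Ioc 0 n, χ (m : ZMod p)‖
      ≤ √p * ((Real.log p + 5) / (Real.pi * √2) + 1) := by
  have h := polya_vinogradov hχ (n + 1)
  have e : ∑ m ∈ range (n + 1), χ (m : ZMod p) = ∑ m ∈ Ioc 0 n, χ (m : ZMod p) := by
    rw [range_eq_Ico, sum_eq_sum_Ico_succ_bot (by omega)]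
    simp only [Nat.cast_zero, MulChar.map_nonunit χ not_isUnit_zero, zero_add]
    rfl
  rwa [e] at h

/-- Character sums over square-free integers, with the Möbius sum split at `D`. -/
lemma norm_sum_squarefree_mulChar_le {p : ℕ} [Fact p.Prime] {χ : MulChar (ZMod p) ℂ} (hχ : χ ≠ 1)
    {x D : ℝ} (hx : 0 ≤ x) (hD : 1 ≤ D) (hDx : D ≤ √x) {N : ℕ} (hN : (N : ℝ) ≤ x) :
    ‖∑ n ∈ Ioc 0 N, if Squarefree n then χ (n : ZMod p) else 0‖
      ≤ √p * ((Real.log p + 5) / (Real.pi * √2) + 1) * (6 / Real.pi ^ 2 * D + cipuConst * √D)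
        + x * (6 / Real.pi ^ 2 * (1 / D - 1 / √x)
        + cipuConst * (7 / 3 * (1 / (D * √D)) - 1 / 3 * (1 / (√x * √(√x))))) := by
  set K := √p * ((Real.log p + 5) / (Real.pi * √2) + 1) with hK
  have hK0 : 0 ≤ K := (norm_nonneg _).trans (polya_vinogradov hχ 0)
  have hYlt : √x < ⌊√x⌋₊ + 1 := Nat.lt_floor_add_one _
  have hNlt : N < (⌊√x⌋₊ + 1) ^ 2 := by
    have : (N : ℝ) < (⌊√x⌋₊ + 1 : ℝ) ^ 2 := by
      refine lt_of_le_of_lt hN ?_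
      calc x = √x ^ 2 := (Real.sq_sqrt hx).symm
        _ < _ := by gcongr
    exact_mod_cast this
  have hfl : ⌊D⌋₊ ≤ ⌊√x⌋₊ := Nat.floor_le_floor hDx
  have hterm : ∀ d : ℕ, ‖((ArithmeticFunction.moebius d : ℤ) : ℂ)
      * ∑ m ∈ Ioc 0 (N / d ^ 2), χ ((d ^ 2 * m : ℕ) : ZMod p)‖
      ≤ (if Squarefree d then 1 else 0) * ‖∑ m ∈ Ioc 0 (N / d ^ 2), χ (m : ZMod p)‖ := by
    intro d
    rw [norm_mul]
    have e : ∑ m ∈ Ioc 0 (N / d ^ 2), χ ((d ^ 2 * m : ℕ) : ZMod p)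
        = χ ((d ^ 2 : ℕ) : ZMod p) * ∑ m ∈ Ioc 0 (N / d ^ 2), χ (m : ZMod p) := by
      rw [mul_sum]
      exact sum_congr rfl fun m _ => by rw [Nat.cast_mul, map_mul]
    have e2 : ‖((ArithmeticFunction.moebius d : ℤ) : ℂ)‖ = if Squarefree d then 1 else 0 := by
      rw [Complex.norm_intCast, ← Int.cast_abs, ArithmeticFunction.abs_moebius]
      split_ifs <;> simp
    rw [e, e2, norm_mul]
    gcongr
    exact mul_le_of_le_one_left (norm_nonneg _) (norm_mulChar_le_one _ _)
  -- For `d ≤ D` the inner sum is bounded by Pólya–Vinogradov, for larger `d` by its length `x /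
  -- d²`.
  have h1 : ∑ d ∈ Ioc 0 ⌊D⌋₊, ((if Squarefree d then (1 : ℝ) else 0)
      * ‖∑ m ∈ Ioc 0 (N / d ^ 2), χ (m : ZMod p)‖)
      ≤ K * (6 / Real.pi ^ 2 * D + cipuConst * √D) := by
    have hQ := (abs_le.mp (abs_sqfreeCount_sub_le hD)).2
    calc _ ≤ ∑ d ∈ Ioc 0 ⌊D⌋₊, (if Squarefree d then (1 : ℝ) else 0) * K := by
          refine sum_le_sum fun d _ => ?_
          gcongr
          exact norm_sum_Ioc_mulChar_le_polya hχ _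
      _ = K * sqfreeCount ⌊D⌋₊ := by
          rw [← sum_mul, sqfreeCount, card_filter, mul_comm]; push_cast; rfl
      _ ≤ _ := by
          gcongr
          linarith
  have h2 : ∑ d ∈ Ioc ⌊D⌋₊ ⌊√x⌋₊, ((if Squarefree d then (1 : ℝ) else 0)
      * ‖∑ m ∈ Ioc 0 (N / d ^ 2), χ (m : ZMod p)‖)
      ≤ x * (6 / Real.pi ^ 2 * (1 / D - 1 / √x)
        + cipuConst * (7 / 3 * (1 / (D * √D)) - 1 / 3 * (1 / (√x * √(√x))))) := by
    refine le_trans ?_ (mul_le_mul_of_nonneg_left (sum_squarefree_one_div_sq_le hD hDx) hx)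
    rw [mul_sum]
    refine sum_le_sum fun d _ => ?_
    have h3 : ‖∑ m ∈ Ioc 0 (N / d ^ 2), χ (m : ZMod p)‖ ≤ x * (1 / (d : ℝ) ^ 2) := by
      refine (norm_sum_Ioc_mulChar_le χ _).trans ?_
      have := Nat.cast_div_le (α := ℝ) (m := N) (n := d ^ 2)
      push_cast at this
      rw [mul_one_div]
      refine this.trans ?_
      gcongr
    calc _ ≤ (if Squarefree d then (1 : ℝ) else 0) * (x * (1 / (d : ℝ) ^ 2)) := by gcongr
      _ = _ := by ring
  rw [sum_squarefree_eq hNlt (fun n => χ (n : ZMod p))]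
  refine (norm_sum_le _ _).trans ((sum_le_sum fun d _ => hterm d).trans ?_)
  rw [← sum_Ioc_consecutive _ (Nat.zero_le _) hfl]
  exact add_le_add h1 h2

end SquarefreePrimitiveRoot

/-! ### Comparison with the error term `E` -/

namespace SquarefreePrimitiveRoot
open Finset

/-- The quantity `c √p log p`. -/
lemma pvConst_mul {p : ℕ} (hp : 1 < p) :
    pvConst p * √p * Real.log p = √p * ((Real.log p + 6) / (Real.pi * √2) + 1) := by
  have : 0 < Real.log p := Real.log_pos (by exact_mod_cast hp)
  rw [pvConst]
  field_simp

/-- The fourth roots in terms of which the error terms are polynomial. -/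
lemma exists_roots {p : ℕ} (hp : 1 < p) {x : ℝ} (hx : 0 < x) :
    ∃ u v γ w : ℝ, 1 ≤ u ∧ 0 < v ∧ 0 < γ ∧ 0 < w ∧ (p : ℝ) = u ^ 8 ∧ Real.log p = v ^ 4
      ∧ pvConst p = γ ^ 4 ∧ x = w ^ 4 ∧ √(p : ℝ) = u ^ 4
      ∧ splitD p x = w ^ 2 / (γ * u * v) ^ 2
      ∧ errE p x = v ^ 2 * (6 / Real.pi ^ 2 * (γ ^ 2 + splitDHat p x * γ ^ 2 - 1 / (u ^ 2 * v ^ 2))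
        + cipuConst * (u * γ ^ 3 * v / w - 1 / 3 * (v ^ 2 / (u ^ 2 * w))
          + 7 / 3 * (u * v * γ ^ 3 / w)))
      ∧ x ^ (1 / 2 : ℝ) = w ^ 2 ∧ (p : ℝ) ^ (-1 / 4 : ℝ) = 1 / u ^ 2
      ∧ (p : ℝ) ^ (1 / 4 : ℝ) = u ^ 2 := by
  have hp1 : (1 : ℝ) < p := by exact_mod_cast hp
  have hp0 : (0 : ℝ) < p := by linarith
  have hL : 0 < Real.log p := Real.log_pos hp1
  have hc : 0 < pvConst p := by rw [pvConst]; positivity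
  have root (y : ℝ) (hy : 0 < y) (n : ℕ) (hn : n ≠ 0) : ∃ r : ℝ, 0 < r ∧ y = r ^ n := by
    refine ⟨y ^ (1 / n : ℝ), by positivity, ?_⟩
    rw [← Real.rpow_natCast, ← Real.rpow_mul hy.le, one_div_mul_cancel (by exact_mod_cast hn),
      Real.rpow_one]
  obtain ⟨u, hu, hpu⟩ := root p hp0 8 (by norm_num)
  obtain ⟨v, hv, hLv⟩ := root _ hL 4 (by norm_num)
  obtain ⟨γ, hγ, hcγ⟩ := root _ hc 4 (by norm_num)
  obtain ⟨w, hw, hxw⟩ := root x hx 4 (by norm_num)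
  have hu1 : 1 ≤ u := by
    by_contra hcon
    have : u ^ 8 ≤ 1 := pow_le_one₀ hu.le (by linarith)
    linarith
  have rp (r : ℝ) (hr : 0 < r) (n : ℕ) (s : ℝ) (k : ℕ) (h : n * s = k) :
      (r ^ n) ^ s = r ^ k := by
    rw [← Real.rpow_natCast r n, ← Real.rpow_mul hr.le, h, Real.rpow_natCast]
  have rn (r : ℝ) (hr : 0 < r) (n : ℕ) (s : ℝ) (k : ℕ) (h : n * s = -k) :
      (r ^ n) ^ s = 1 / r ^ k := by
    rw [← Real.rpow_natCast r n, ← Real.rpow_mul hr.le, h, Real.rpow_neg hr.le, Real.rpow_natCast,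
      one_div]
  have hsq : √(p : ℝ) = u ^ 4 := by
    rw [hpu, show u ^ 8 = (u ^ 4) ^ 2 by ring, Real.sqrt_sq (by positivity)]
  refine ⟨u, v, γ, w, hu1, hv, hγ, hw, hpu, hLv, hcγ, hxw, hsq, ?_, ?_, ?_, ?_, ?_⟩
  · rw [splitD, hsq, hLv, hcγ, hxw,
      show w ^ 4 / (γ ^ 4 * u ^ 4 * v ^ 4) = (w / (γ * u * v)) ^ 4 by field_simp,
      rp _ (by positivity) 4 _ 2 (by norm_num), div_pow]
  · rw [errE, hLv, hcγ, hpu, hxw, rp v hv 4 (1 / 2) 2 (by norm_num),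
      rp γ hγ 4 (1 / 2) 2 (by norm_num), rn u hu 8 (-1 / 4) 2 (by norm_num),
      rn v hv 4 (-1 / 2) 2 (by norm_num), rp u hu 8 (1 / 8) 1 (by norm_num),
      rn w hw 4 (-1 / 4) 1 (by norm_num), rp γ hγ 4 (3 / 4) 3 (by norm_num),
      rp v hv 4 (1 / 4) 1 (by norm_num)]
    congr 1
    field_simp
  · rw [hxw, rp w hw 4 (1 / 2) 2 (by norm_num)]
  · rw [hpu, rn u hu 8 (-1 / 4) 2 (by norm_num)]
  · rw [hpu, rp u hu 8 (1 / 4) 2 (by norm_num)]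

/-- `E √x p^(1/4)`, the bound for each character sum over square-free integers. -/
noncomputable def charErr (p : ℕ) (x : ℝ) : ℝ :=
  errE p x * x ^ (1 / 2 : ℝ) * (p : ℝ) ^ (1 / 4 : ℝ)

lemma two_mul_le_pvConst_mul {p : ℕ} (hp : 1 < p) :
    2 * √p ≤ pvConst p * √p * Real.log p := by
  have hL : 0 < Real.log p := Real.log_pos (by exact_mod_cast hp)
  have hU := one_div_pi_mul_sqrt_two_ge
  rw [pvConst_mul hp, mul_comm, div_eq_mul_one_div]
  gcongr
  nlinarith

lemma splitD_lt_splitDHat_bound {D : ℝ} (hD : 1 < D) : 1 + 1 / D ≤ D / (D - 1) := by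
  have h0 : 0 < D - 1 := by linarith
  rw [le_div_iff₀ h0]
  have : 0 < D := by linarith
  field_simp
  nlinarith

/-- Here `u = p^(1/8)`, `κ⁴ = c√p log p`, `w = x^(1/4)`, `L = log p`. The term `E` subtracts `A/3`
times `log p`, where the argument yields only `A/3` times 1. The right side is what pays for this:
the first summand from `D̂ ≥ 1 + 1/D`, the second from proving Pólya–Vinogradov with 5 in place of
the 6 in `c`. The two are combined by the arithmetic–geometric mean inequality. -/
lemma slack_le {u κ w L : ℝ} (hu : 1 ≤ u) (hκ : 0 < κ) (hw : 0 < w) (hκu : 2 * u ^ 4 ≤ κ ^ 4)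
    (hL : L ≤ 8 * (u ^ 3 - 1) / 3) :
    cipuConst / 3 * w * (L - 1)
      ≤ 6 / Real.pi ^ 2 * κ ^ 4 + 0.225 * u ^ 4 * (6 / Real.pi ^ 2 * (w ^ 2 / κ ^ 2)) := by
  have ha := six_div_pi_sq_mem.1
  generalize 6 / Real.pi ^ 2 = a at ha
  have hu0 : 0 < u := by linarith
  have hκ1 : 1.18 * u ≤ κ := by
    refine le_of_pow_le_pow_left₀ (n := 4) (by norm_num) hκ.le ?_
    rw [mul_pow]
    have : 0 < u ^ 4 := by positivity
    norm_num
    linarith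
  have h1 : 2 * (κ ^ 2) * (0.474 * u ^ 2 * (w / κ)) ≤ κ ^ 4 + 0.225 * u ^ 4 * (w ^ 2 / κ ^ 2) := by
    have h2 := two_mul_le_add_sq (κ ^ 2) (0.474 * u ^ 2 * (w / κ))
    have h3 : (0.474 * u ^ 2 * (w / κ)) ^ 2 ≤ 0.225 * u ^ 4 * (w ^ 2 / κ ^ 2) := by
      rw [mul_pow, mul_pow, div_pow, ← pow_mul]
      gcongr
      norm_num
    nlinarith
  have h4 : 2 * (κ ^ 2) * (0.474 * u ^ 2 * (w / κ)) = 0.948 * u ^ 2 * w * κ := by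
    field_simp; norm_num
  have h5 : 0.948 * u ^ 2 * w * (1.18 * u) ≤ 0.948 * u ^ 2 * w * κ := by gcongr
  have h6 : a * (0.948 * u ^ 2 * w * (1.18 * u)) ≤ a * (κ ^ 4 + 0.225 * u ^ 4 * (w ^ 2 / κ ^ 2)) := by
    gcongr
    linarith
  have h7 : 0.6079271 * (0.948 * u ^ 2 * w * (1.18 * u)) ≤ a * (0.948 * u ^ 2 * w * (1.18 * u)) := by
    gcongr
  have h8 : cipuConst / 3 * w * (L - 1) ≤ cipuConst / 3 * w * (8 * (u ^ 3 - 1) / 3 - 1) := by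
    rw [cipuConst]; gcongr
  rw [cipuConst] at *
  have h9 : 0 < w * u ^ 3 := by positivity
  nlinarith

theorem norm_sum_squarefree_mulChar_le_charErr {p : ℕ} [Fact p.Prime] {χ : MulChar (ZMod p) ℂ}
    (hχ : χ ≠ 1) {x : ℝ} (hx : 0 < x) (hD : 1 < splitD p x) {N : ℕ} (hN : (N : ℝ) ≤ x) :
    ‖∑ n ∈ Ioc 0 N, if Squarefree n then χ (n : ZMod p) else 0‖ ≤ charErr p x := by
  have hp1 := (Fact.out : p.Prime).one_lt
  have hK2 := two_mul_le_pvConst_mul hp1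
  have hKe := pvConst_mul hp1
  have hU := one_div_pi_mul_sqrt_two_ge
  obtain ⟨u, v, γ, w, hu, hv, hγ, hw, hpu, hLv, hcγ, hxw, hsq, hDe, hE, hx2, -, hp4⟩ :=
    exists_roots hp1 hx
  have hu0 : 0 < u := by linarith
  set κ := γ * u * v with hκ
  have hκ0 : 0 < κ := by positivity
  have hKκ : pvConst p * √p * Real.log p = κ ^ 4 := by rw [hcγ, hsq, hLv, hκ]; ring
  rw [hKκ, hsq] at hK2
  have hsx : √x = w ^ 2 := by
    rw [hxw, show w ^ 4 = (w ^ 2) ^ 2 by ring, Real.sqrt_sq (by positivity)]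
  have hssx : √(w ^ 2) = w := Real.sqrt_sq hw.le
  have hsD : √(splitD p x) = w / κ := by
    rw [hDe, ← div_pow, Real.sqrt_sq (by positivity)]
  have hκ1 : 1 ≤ κ ^ 2 := by
    have : (1 : ℝ) ≤ u ^ 4 := one_le_pow₀ hu
    nlinarith [sq_nonneg (κ ^ 2)]
  have hDx : splitD p x ≤ √x := by
    rw [hDe, hsx]
    exact div_le_self (by positivity) hκ1
  refine (norm_sum_squarefree_mulChar_le hχ hx.le hD.le hDx hN).trans ?_
  have hK' : √p * ((Real.log p + 5) / (Real.pi * √2) + 1) ≤ κ ^ 4 - 0.225 * u ^ 4 := by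
    rw [← hKκ, hKe, hsq, div_eq_mul_one_div (_ + 5), div_eq_mul_one_div (_ + 6)]
    have : 0 < u ^ 4 := by positivity
    nlinarith
  -- Since `p = u⁸`, this is `log y ≤ y - 1` at `y = u³`, the power matching `w u³` in the slack.
  have hlog : Real.log p ≤ 8 * (u ^ 3 - 1) / 3 := by
    have h1 := Real.log_le_sub_one_of_pos (show 0 < u ^ 3 by positivity)
    rw [Real.log_pow] at h1
    rw [hpu, Real.log_pow]
    push_cast at h1 ⊢
    linarith
  have hslack := slack_le hu hκ0 hw hK2 hlog
  have hDhat : 1 + κ ^ 2 / w ^ 2 ≤ splitDHat p x := by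
    have := splitD_lt_splitDHat_bound hD
    rw [splitDHat]
    refine le_trans (le_of_eq ?_) this
    rw [hDe, one_div_div]
  rw [charErr, hE, hx2, hp4, hsx, hssx, hsD, hDe]
  set a := 6 / Real.pi ^ 2 with ha
  have ha0 : 0 < a := by positivity
  have hA0 : 0 < cipuConst := by rw [cipuConst]; norm_num
  set A := cipuConst
  have e1 : v ^ 2 * (a * (γ ^ 2 + splitDHat p x * γ ^ 2 - 1 / (u ^ 2 * v ^ 2))
        + A * (u * γ ^ 3 * v / w - 1 / 3 * (v ^ 2 / (u ^ 2 * w))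
          + 7 / 3 * (u * v * γ ^ 3 / w))) * w ^ 2 * u ^ 2
      = a * (w ^ 2 * κ ^ 2 * (1 + splitDHat p x) - w ^ 2)
        + A * (10 / 3 * (w * κ ^ 3) - 1 / 3 * (w * v ^ 4)) := by
    rw [hκ]; field_simp; ring
  have e2 : x * (a * (1 / (w ^ 2 / κ ^ 2) - 1 / w ^ 2)
        + A * (7 / 3 * (1 / (w ^ 2 / κ ^ 2 * (w / κ))) - 1 / 3 * (1 / (w ^ 2 * w))))
      = a * (w ^ 2 * κ ^ 2 - w ^ 2) + A * (7 / 3 * (w * κ ^ 3) - 1 / 3 * w) := by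
    rw [hxw]; field_simp
  have e3 : (κ ^ 4 - 0.225 * u ^ 4) * (a * (w ^ 2 / κ ^ 2) + A * (w / κ))
      = a * (w ^ 2 * κ ^ 2) + A * (w * κ ^ 3)
        - 0.225 * u ^ 4 * (a * (w ^ 2 / κ ^ 2)) - 0.225 * u ^ 4 * (A * (w / κ)) := by
    field_simp; ring
  have h1 := mul_le_mul_of_nonneg_right hK'
    (show 0 ≤ a * (w ^ 2 / κ ^ 2) + A * (w / κ) by positivity)
  have h2 : a * (w ^ 2 * κ ^ 2 * (1 + (1 + κ ^ 2 / w ^ 2)))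
      ≤ a * (w ^ 2 * κ ^ 2 * (1 + splitDHat p x)) := by gcongr
  have e4 : a * (w ^ 2 * κ ^ 2 * (1 + (1 + κ ^ 2 / w ^ 2)))
      = 2 * (a * (w ^ 2 * κ ^ 2)) + a * κ ^ 4 := by field_simp; ring
  have h3 : 0 ≤ 0.225 * u ^ 4 * (A * (w / κ)) := by positivity
  rw [e1, e2]
  rw [e3] at h1
  rw [hLv] at hslack
  linarith

end SquarefreePrimitiveRoot

/-! ### The sieve with characters of prime order -/

namespace SquarefreePrimitiveRoot
open Finset

/-- For a character `χ` of prime order `r`, the weight `-(r - 1)⁻¹ ∑_{1 ≤ i < r} χ (n) ^ i`, written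
out: `1 + w` is a multiple of the indicator function of `χ n ≠ 1`. -/
noncomputable def nonresidueWeight {p : ℕ} (χ : MulChar (ZMod p) ℂ) (r : ℕ) (n : ℕ) : ℝ :=
  open Classical in if χ (n : ZMod p) = 1 then -1 else 1 / ((r : ℝ) - 1)

lemma nonresidueWeight_eq {p : ℕ} [Fact p.Prime] {χ : MulChar (ZMod p) ℂ} {r : ℕ} (hr : r.Prime)
    (hχ : orderOf χ = r) {n : ℕ} (hn : n.Coprime p) :
    (nonresidueWeight χ r n : ℂ)
      = -(1 / ((r : ℂ) - 1)) * ∑ i ∈ range (r - 1), (χ ^ (i + 1)) (n : ZMod p) := by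
  have hu : IsUnit (n : ZMod p) := (ZMod.isUnit_iff_coprime n p).mpr hn
  have hr1 : (r : ℂ) - 1 ≠ 0 := sub_ne_zero.mpr (by exact_mod_cast hr.one_lt.ne')
  have hpow : χ (n : ZMod p) ^ r = 1 := by
    rw [← MulChar.pow_apply' χ hr.ne_zero, ← hχ, pow_orderOf_eq_one, MulChar.one_apply hu]
  have hsum : ∑ i ∈ range (r - 1), (χ ^ (i + 1)) (n : ZMod p)
      = ∑ i ∈ range (r - 1), χ (n : ZMod p) ^ (i + 1) :=
    sum_congr rfl fun i _ => MulChar.pow_apply' χ (Nat.succ_ne_zero i) _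
  rw [hsum, nonresidueWeight]
  split_ifs with h
  · simp only [h, one_pow, sum_const, card_range, nsmul_eq_mul, mul_one]
    rw [Nat.cast_pred hr.pos]
    push_cast
    field_simp
  · have h1 := geom_sum_mul (χ (n : ZMod p)) r
    rw [hpow, sub_self, mul_eq_zero, or_iff_left (sub_ne_zero.mpr h)] at h1
    obtain ⟨k, rfl⟩ : ∃ k, r = k + 1 := ⟨r - 1, by have := hr.pos; omega⟩
    rw [sum_range_succ', pow_zero] at h1
    rw [Nat.add_sub_cancel, eq_neg_of_add_eq_zero_left h1]
    push_cast
    ring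

lemma nonresidueWeight_indicator {p : ℕ} (χ : MulChar (ZMod p) ℂ) {r : ℕ} (hr : 1 < r) (n : ℕ) :
    (χ (n : ZMod p) = 1 ∧ (1 - 1 / (r : ℝ)) * (1 + nonresidueWeight χ r n) = 0)
      ∨ (χ (n : ZMod p) ≠ 1 ∧ (1 - 1 / (r : ℝ)) * (1 + nonresidueWeight χ r n) = 1) := by
  have hr' : (1 : ℝ) < r := by exact_mod_cast hr
  have h0 : (r : ℝ) ≠ 0 := by linarith
  have h1 : (r : ℝ) - 1 ≠ 0 := by linarith
  rw [nonresidueWeight]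
  split_ifs with h
  · left; simp [h]
  · right
    refine ⟨h, ?_⟩
    field_simp
    ring

/-- Each weight is minus an average of `r - 1` characters, so multiplying by it does not enlarge the
bound. The twist `ψ` collects the characters already expanded; its order is prime to the remaining
`r`, which keeps the product nonprincipal. -/
lemma norm_sum_mul_prod_weight_le {p : ℕ} [Fact p.Prime] {S : Finset ℕ}
    (hS : ∀ n ∈ S, n.Coprime p) {err : ℝ}
    (herr : ∀ χ : MulChar (ZMod p) ℂ, χ ≠ 1 → ‖∑ n ∈ S, χ (n : ZMod p)‖ ≤ err)
    (χ : ℕ → MulChar (ZMod p) ℂ) (B : Finset ℕ) (hB : ∀ r ∈ B, r.Prime ∧ orderOf (χ r) = r)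
    (ψ : MulChar (ZMod p) ℂ) (m : ℕ) (hψ : ψ ^ m = 1) (hm : ∀ r ∈ B, m.Coprime r)
    (hne : ψ ≠ 1 ∨ B.Nonempty) :
    ‖∑ n ∈ S, ψ (n : ZMod p) * ∏ r ∈ B, (nonresidueWeight (χ r) r n : ℂ)‖ ≤ err := by
  induction B using Finset.induction_on generalizing ψ m with
  | empty =>
    simp only [prod_empty, mul_one]
    exact herr ψ (hne.resolve_right (by simp))
  | insert r B hrB ih =>
    obtain ⟨hr, hord⟩ := hB r (mem_insert_self _ _)
    have hr1 : (1 : ℝ) < r := by exact_mod_cast hr.one_lt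
    have hcop := hm r (mem_insert_self _ _)
    have hterm : ∀ i ∈ range (r - 1), ‖∑ n ∈ S, (ψ * (χ r) ^ (i + 1)) (n : ZMod p)
        * ∏ r ∈ B, (nonresidueWeight (χ r) r n : ℂ)‖ ≤ err := by
      intro i hi
      refine ih (fun r' h' => hB r' (mem_insert_of_mem h')) _ (m * r) ?_ ?_ (Or.inl ?_)
      · have hpow := pow_orderOf_eq_one (χ r)
        rw [hord] at hpow
        rw [mul_pow, pow_mul, hψ, one_pow, one_mul, ← pow_mul,
          show (i + 1) * (m * r) = r * ((i + 1) * m) by ring, pow_mul, hpow, one_pow]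
      · intro r' h'
        refine Nat.Coprime.mul_left (hm r' (mem_insert_of_mem h')) ?_
        rw [Nat.coprime_primes hr (hB r' (mem_insert_of_mem h')).1]
        rintro rfl
        exact hrB h'
      · intro h1
        have h2 : (χ r) ^ ((i + 1) * m) = 1 := by
          have := congrArg (· ^ m) h1
          simpa only [mul_pow, hψ, one_mul, one_pow, ← pow_mul] using this
        rw [← orderOf_dvd_iff_pow_eq_one, hord] at h2
        have h3 := Nat.le_of_dvd (Nat.succ_pos i) (hcop.symm.dvd_of_dvd_mul_right h2)
        have := mem_range.mp hi
        omega
    have e : ∑ n ∈ S, ψ (n : ZMod p) * ∏ r ∈ insert r B, (nonresidueWeight (χ r) r n : ℂ)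
        = -(1 / ((r : ℂ) - 1)) * ∑ i ∈ range (r - 1), ∑ n ∈ S, (ψ * (χ r) ^ (i + 1)) (n : ZMod p)
        * ∏ r ∈ B, (nonresidueWeight (χ r) r n : ℂ) := by
      rw [sum_comm, mul_sum]
      refine sum_congr rfl fun n hn => ?_
      rw [prod_insert hrB, nonresidueWeight_eq hr hord (hS n hn), ← sum_mul]
      simp only [MulChar.mul_apply, ← mul_sum]
      ring
    rw [e, norm_mul]
    have h1 : ‖-(1 / ((r : ℂ) - 1))‖ = 1 / ((r : ℝ) - 1) := by
      rw [norm_neg, norm_div, norm_one]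
      congr 1
      rw [show (r : ℂ) - 1 = ((r - 1 : ℝ) : ℂ) by push_cast; rfl, Complex.norm_real,
        Real.norm_of_nonneg (by linarith)]
    rw [h1, div_mul_eq_mul_div, one_mul, div_le_iff₀ (by linarith)]
    refine (norm_sum_le_of_le _ hterm).trans (le_of_eq ?_)
    rw [sum_const, card_range, nsmul_eq_mul, Nat.cast_pred hr.pos, mul_comm]

lemma abs_sum_prod_weight_le {p : ℕ} [Fact p.Prime] {S : Finset ℕ}
    (hS : ∀ n ∈ S, n.Coprime p) {err : ℝ}
    (herr : ∀ χ : MulChar (ZMod p) ℂ, χ ≠ 1 → ‖∑ n ∈ S, χ (n : ZMod p)‖ ≤ err)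
    (χ : ℕ → MulChar (ZMod p) ℂ) {B : Finset ℕ} (hB : ∀ r ∈ B, r.Prime ∧ orderOf (χ r) = r)
    (hne : B.Nonempty) :
    |∑ n ∈ S, ∏ r ∈ B, nonresidueWeight (χ r) r n| ≤ err := by
  have h := norm_sum_mul_prod_weight_le hS herr χ B hB 1 1 (one_pow 1)
    (fun r _ => Nat.coprime_one_left r) (Or.inr hne)
  have e : ∑ n ∈ S, (1 : MulChar (ZMod p) ℂ) (n : ZMod p)
      * ∏ r ∈ B, (nonresidueWeight (χ r) r n : ℂ)
      = ((∑ n ∈ S, ∏ r ∈ B, nonresidueWeight (χ r) r n : ℝ) : ℂ) := by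
    push_cast
    refine sum_congr rfl fun n hn => ?_
    rw [MulChar.one_apply ((ZMod.isUnit_iff_coprime n p).mpr (hS n hn)), one_mul]
  rwa [e, Complex.norm_real, Real.norm_eq_abs] at h

/-- The lower-bound sieve weight: exact indicators over `A`, a union bound over `Q`. It can be
positive only where every condition holds. -/
lemma prod_mul_one_sub_sum_nonpos {ι κ : Type*} (A : Finset ι) (Q : Finset κ) (f : ι → ℝ) (g : κ → ℝ)
    (hf : ∀ i ∈ A, f i = 0 ∨ f i = 1) (hg : ∀ i ∈ Q, g i = 0 ∨ g i = 1)
    (h : (∃ i ∈ A, f i = 0) ∨ ∃ i ∈ Q, g i = 0) :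
    (∏ i ∈ A, f i) * (1 - ∑ i ∈ Q, (1 - g i)) ≤ 0 := by
  rcases h with ⟨i, hi, h0⟩ | ⟨i, hi, h0⟩
  · rw [prod_eq_zero hi h0, zero_mul]
  · refine mul_nonpos_of_nonneg_of_nonpos
      (prod_nonneg fun j hj => by rcases hf j hj with h | h <;> rw [h]; norm_num) ?_
    have h1 : 1 - g i ≤ ∑ i ∈ Q, (1 - g i) :=
      single_le_sum (f := fun i => 1 - g i)
        (fun j hj => by rcases hg j hj with h | h <;> simp [h]) hi
    rw [h0] at h1
    linarith

/-- The prime sieve: if the main term dominates, some `n ∈ S` survives. -/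
theorem exists_apply_ne_one {p : ℕ} [Fact p.Prime] {S : Finset ℕ}
    (hS : ∀ n ∈ S, n.Coprime p) {err : ℝ}
    (herr : ∀ χ : MulChar (ZMod p) ℂ, χ ≠ 1 → ‖∑ n ∈ S, χ (n : ZMod p)‖ ≤ err)
    (χ : ℕ → MulChar (ZMod p) ℂ) (A : Finset ℕ) (hA : ∀ r ∈ A, r.Prime ∧ orderOf (χ r) = r)
    {s : ℕ} (q : Fin s → ℕ) (hq : ∀ i, (q i).Prime ∧ orderOf (χ (q i)) = q i)
    (hqA : ∀ i, q i ∉ A) (hδ : 0 < sieveDelta q)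
    (hmain : err * (2 ^ #A * sieveBigDelta q - 1) < #S) :
    ∃ n ∈ S, (∀ r ∈ A, χ r (n : ZMod p) ≠ 1) ∧ ∀ i, χ (q i) (n : ZMod p) ≠ 1 := by
  by_contra! hcon
  set W : ℕ → ℕ → ℝ := fun r n => nonresidueWeight (χ r) r n with hW
  set δ := sieveDelta q with hδdef
  have hq1 (i : Fin s) : 1 ≤ (q i : ℝ) := by exact_mod_cast (hq i).1.one_le
  have hpt : ∀ n ∈ S, (∏ r ∈ A, (1 - 1 / (r : ℝ)) * (1 + W r n))
      * (δ + ∑ i, (1 - 1 / (q i : ℝ)) * W (q i) n) ≤ 0 := by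
    intro n hn
    have h := prod_mul_one_sub_sum_nonpos A univ (fun r => (1 - 1 / (r : ℝ)) * (1 + W r n))
      (fun i => (1 - 1 / (q i : ℝ)) * (1 + W (q i) n)) ?_ ?_ ?_
    · convert h using 2
      rw [hδdef, sieveDelta, sub_add, ← sum_sub_distrib]
      congr 1
      exact sum_congr rfl fun i _ => by ring
    · intro r hr
      rcases nonresidueWeight_indicator (χ r) (hA r hr).1.one_lt n with h | h
      exacts [Or.inl h.2, Or.inr h.2]
    · intro i _
      rcases nonresidueWeight_indicator (χ (q i)) (hq i).1.one_lt n with h | h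
      exacts [Or.inl h.2, Or.inr h.2]
    · by_cases hall : ∀ r ∈ A, χ r (n : ZMod p) ≠ 1
      · obtain ⟨i, hi⟩ := hcon n hn hall
        right
        refine ⟨i, mem_univ _, ?_⟩
        rcases nonresidueWeight_indicator (χ (q i)) (hq i).1.one_lt n with h | h
        exacts [h.2, absurd hi h.1]
      · push Not at hall
        obtain ⟨r, hr, hr1⟩ := hall
        left
        refine ⟨r, hr, ?_⟩
        rcases nonresidueWeight_indicator (χ r) (hA r hr).1.one_lt n with h | h
        exacts [h.2, absurd hr1 h.1]
  have hθ : 0 < ∏ r ∈ A, (1 - 1 / (r : ℝ)) := by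
    refine prod_pos fun r hr => ?_
    have : (1 : ℝ) < r := by exact_mod_cast (hA r hr).1.one_lt
    rw [sub_pos, div_lt_one (by linarith)]
    exact this
  have hpt' : ∀ n ∈ S, (∏ r ∈ A, (1 + W r n))
      * (δ + ∑ i, (1 - 1 / (q i : ℝ)) * W (q i) n) ≤ 0 := by
    intro n hn
    have h := hpt n hn
    rw [prod_mul_distrib, mul_assoc] at h
    exact nonpos_of_mul_nonpos_right h hθ
  have hsum := sum_nonpos hpt'
  -- Among these sums only `e ∅ = #S` is a main term; every other one is at least `-err`.
  set e : Finset ℕ → ℝ := fun B => ∑ n ∈ S, ∏ r ∈ B, W r n with he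
  have hexp : ∑ n ∈ S, (∏ r ∈ A, (1 + W r n)) * (δ + ∑ i, (1 - 1 / (q i : ℝ)) * W (q i) n)
      = ∑ B ∈ A.powerset, (δ * e B + ∑ i, (1 - 1 / (q i : ℝ)) * e (insert (q i) B)) := by
    simp only [prod_one_add, he, mul_sum]
    simp_rw [sum_mul]
    rw [sum_comm]
    refine sum_congr rfl fun B hB => ?_
    rw [sum_comm, ← sum_add_distrib]
    refine sum_congr rfl fun n _ => ?_
    rw [mul_add, mul_sum, mul_comm]
    congr 1
    refine sum_congr rfl fun i _ => ?_
    rw [prod_insert (fun h => hqA i (mem_powerset.mp hB h))]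
    ring
  have hbound : ∀ B ∈ A.powerset, ∀ i, -err ≤ e (insert (q i) B) := by
    intro B hB i
    refine (abs_le.mp (abs_sum_prod_weight_le hS herr χ (B := insert (q i) B) ?_ ⟨q i, by simp⟩)).1
    intro r hr
    rcases mem_insert.mp hr with rfl | hr
    exacts [hq i, hA r (mem_powerset.mp hB hr)]
  have hbound0 : ∀ B ∈ A.powerset.erase ∅, -err ≤ e B := by
    intro B hB
    rw [mem_erase] at hB
    exact (abs_le.mp (abs_sum_prod_weight_le hS herr χ
      (fun r hr => hA r (mem_powerset.mp hB.2 hr)) (nonempty_iff_ne_empty.mpr hB.1))).1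
  have hcoef : ∑ i, (1 - 1 / (q i : ℝ)) = s - 1 + δ := by
    rw [sum_sub_distrib, hδdef, sieveDelta]; simp
  have h1 : -err * (s - 1 + δ) * 2 ^ #A
      ≤ ∑ B ∈ A.powerset, ∑ i, (1 - 1 / (q i : ℝ)) * e (insert (q i) B) := by
    have : ∑ B ∈ A.powerset, -err * (s - 1 + δ) = -err * (s - 1 + δ) * 2 ^ #A := by
      rw [sum_const, card_powerset, nsmul_eq_mul]; push_cast; ring
    rw [← this]
    refine sum_le_sum fun B hB => ?_
    rw [← hcoef, mul_sum]
    refine sum_le_sum fun i _ => ?_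
    rw [mul_comm]
    refine mul_le_mul_of_nonneg_left (hbound B hB i) ?_
    rw [sub_nonneg]
    exact (div_le_one (by linarith [hq1 i])).mpr (hq1 i)
  have h2 : #S - err * (2 ^ #A - 1) ≤ ∑ B ∈ A.powerset, e B := by
    rw [← add_sum_erase _ _ (empty_mem_powerset A)]
    have h3 := sum_le_sum hbound0
    rw [sum_const, card_erase_of_mem (empty_mem_powerset A), card_powerset, nsmul_eq_mul,
      Nat.cast_pred (by positivity)] at h3
    have h4 : e ∅ = #S := by simp [he]
    rw [h4]
    push_cast at h3
    linarith
  rw [hexp, sum_add_distrib, ← mul_sum] at hsum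
  have h5 := mul_le_mul_of_nonneg_left h2 hδ.le
  -- Total cost: `2^#A - 1` errors weighted by `δ`, plus `2^#A` errors weighted by `∑ (1 - 1/q i) =
  -- s - 1 + δ`.
  have h6 : δ * (err * (2 ^ #A * sieveBigDelta q - 1))
      = δ * (err * (2 ^ #A - 1)) + err * (s - 1 + δ) * 2 ^ #A := by
    rw [sieveBigDelta, ← hδdef]
    field_simp
    ring
  have h7 := mul_lt_mul_of_pos_left hmain hδ
  linarith

lemma exists_mulChar_orderOf_eq {p : ℕ} [Fact p.Prime] {r : ℕ} (hr : r ≠ 0) (h : r ∣ p - 1) :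
    ∃ χ : MulChar (ZMod p) ℂ, orderOf χ = r :=
  MulChar.exists_mulChar_orderOf (ZMod p) (by rwa [ZMod.card])
    (Complex.isPrimitiveRoot_exp r hr)

/-- If the order were a proper divisor of `p - 1`, then `n` would be an `r`-th power for some prime
`r ∣ p - 1`, and a character of order `r` is 1 on `r`-th powers. -/
lemma isPrimRootMod_of_apply_ne_one {p : ℕ} [Fact p.Prime] (χ : ℕ → MulChar (ZMod p) ℂ)
    (hχ : ∀ r, r.Prime → r ∣ p - 1 → orderOf (χ r) = r) {n : ℕ} (hn : n.Coprime p)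
    (h : ∀ r, r.Prime → r ∣ p - 1 → χ r (n : ZMod p) ≠ 1) : IsPrimRootMod n p := by
  have hp := (Fact.out : p.Prime)
  refine ⟨hn, ?_⟩
  rw [Nat.totient_prime hp]
  set u := ZMod.unitOfCoprime n hn with hu
  have hun : (u : ZMod p) = n := ZMod.coe_unitOfCoprime n hn
  rw [← hun, orderOf_units]
  have hcard : Nat.card (ZMod p)ˣ = p - 1 := by
    rw [Nat.card_eq_fintype_card, ZMod.card_units]
  refine orderOf_eq_of_pow_and_pow_div_prime (by have := hp.two_le; omega) ?_ ?_
  · rw [← hcard, pow_card_eq_one']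
  · intro r hr hrp h1
    apply h r hr hrp
    obtain ⟨g, hg⟩ := IsCyclic.exists_generator (α := (ZMod p)ˣ)
    obtain ⟨j, hj⟩ := (mem_powers_iff_mem_zpowers.mpr (hg u) : u ∈ Submonoid.powers g)
    have hj : g ^ j = u := hj
    have hord : orderOf g = p - 1 := by
      rw [orderOf_eq_card_of_forall_mem_zpowers hg, hcard]
    rw [← hj, ← pow_mul, ← orderOf_dvd_iff_pow_eq_one, hord] at h1
    have h2 : r ∣ j := by
      obtain ⟨t, ht⟩ := hrp
      rw [ht, Nat.mul_div_cancel_left t hr.pos] at h1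
      have ht0 : 0 < t := by
        rcases Nat.eq_zero_or_pos t with rfl | h
        · have := hp.two_le; omega
        · exact h
      exact Nat.dvd_of_mul_dvd_mul_right ht0 h1
    obtain ⟨t, rfl⟩ := h2
    rw [← hun, ← hj, pow_mul, pow_right_comm, Units.val_pow_eq_pow_val,
      map_pow, ← MulChar.pow_apply' _ hr.ne_zero]
    nth_rewrite 2 [← hχ r hr hrp]
    rw [pow_orderOf_eq_one, MulChar.one_apply (Units.isUnit _)]

end SquarefreePrimitiveRoot

/-! ### Large `x`, and absorption of the secondary terms -/

namespace SquarefreePrimitiveRoot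
open Finset

/-- Telescoping of `1/d² ≤ 1/(d - 1/2) - 1/(d + 1/2)` from `d = 2`. -/
lemma sum_one_div_sq_le (Y : ℕ) :
    ∑ d ∈ Ioc 1 (Y + 1), 1 / (d : ℝ) ^ 2 ≤ 2 / 3 - 1 / ((Y : ℝ) + 3 / 2) := by
  induction Y with
  | zero => norm_num
  | succ Y ih =>
    rw [sum_Ioc_succ_top (by omega)]
    have h : 1 / ((Y + 1 + 1 : ℕ) : ℝ) ^ 2 ≤ 1 / ((Y : ℝ) + 3 / 2) - 1 / (Y + 5 / 2) := by
      push_cast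
      rw [div_sub_div _ _ (by positivity) (by positivity),
        div_le_div_iff₀ (by positivity) (by positivity)]
      nlinarith
    have e : ((Y + 1 : ℕ) : ℝ) + 3 / 2 = Y + 5 / 2 := by push_cast; ring
    rw [e]
    linarith

lemma card_filter_dvd_add_mul_le {p d : ℕ} (hcop : d.Coprime p) (g J : ℕ) :
    #{j ∈ range J | d ∣ g + p * j} ≤ J / d + 1 := by
  rw [← card_range (J / d + 1)]
  refine card_le_card_of_injOn (fun j => j / d) ?_ ?_
  · intro j hj
    simp only [coe_filter, mem_range, Set.mem_ofPred_eq] at hj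
    simp only [coe_range, Set.mem_Iio]
    exact Nat.lt_succ_of_le (Nat.div_le_div_right hj.1.le)
  · intro i hi j hj hij
    simp only [coe_filter, mem_range, Set.mem_ofPred_eq] at hi hj
    have h1 : g + p * i ≡ g + p * j [MOD d] :=
      (Nat.modEq_zero_iff_dvd.mpr hi.2).trans (Nat.modEq_zero_iff_dvd.mpr hj.2).symm
    have h2 : i ≡ j [MOD d] :=
      Nat.ModEq.cancel_left_of_coprime hcop (Nat.ModEq.add_left_cancel' g h1)
    have h3 : i % d = j % d := h2
    rw [← Nat.div_add_mod i d, ← Nat.div_add_mod j d, h3]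
    simp only at hij
    rw [hij]

/-- Every reduced residue class contains a square-free number of size `O(p²)`. -/
lemma exists_squarefree_modEq {p : ℕ} (hp : p.Prime) {g : ℕ} (hg : g.Coprime p) (hgp : g < p)
    {x : ℝ} (hx : 0 < x) (hpx : 3.3 * p ≤ √x) :
    ∃ n : ℕ, Squarefree n ∧ (n : ZMod p) = g ∧ (n : ℝ) < x := by
  have hp2 : (2 : ℝ) ≤ p := by exact_mod_cast hp.two_le
  have hsx : √x * √x = x := Real.mul_self_sqrt hx.le
  set J := ⌊x / p⌋₊ with hJ
  have hJle : (J : ℝ) ≤ x / p := Nat.floor_le (by positivity)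
  have hJlt : x / p < J + 1 := Nat.lt_floor_add_one _
  have hJp : (J : ℝ) * p ≤ x := by rwa [le_div_iff₀ (by positivity)] at hJle
  have hlt : ∀ j ∈ range J, ((g + p * j : ℕ) : ℝ) < x := by
    intro j hj
    refine lt_of_lt_of_le ?_ hJp
    have h1 : g + p * j < J * p := by
      have := mem_range.mp hj
      calc g + p * j < p + p * j := by omega
        _ = (j + 1) * p := by ring
        _ ≤ J * p := Nat.mul_le_mul_right p this
    exact_mod_cast h1
  by_contra! hcon
  have hnsq : ∀ j ∈ range J, ¬ Squarefree (g + p * j) := by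
    intro j hj hsq
    exact absurd (hlt j hj) (not_lt.mpr (hcon _ hsq (by push_cast; simp)))
  obtain ⟨Y, hY⟩ : ∃ Y, ⌊√x⌋₊ = Y + 1 := by
    refine ⟨⌊√x⌋₊ - 1, ?_⟩
    have : 1 ≤ ⌊√x⌋₊ := Nat.le_floor (by push_cast; linarith)
    omega
  have hYle : ((Y + 1 : ℕ) : ℝ) ≤ √x := by rw [← hY]; exact Nat.floor_le (Real.sqrt_nonneg _)
  -- If all terms `g + pj < x` fail to be square-free, each is divisible by some `d²` with `1 < d ≤
  -- √x`, `d` prime to `p`. A given `d` accounts for at most `J/d² + 1` of them, so `J ≤ 2J/3 + Y`,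
  -- against `J > 3.3 √x - 1`.
  have hcover : range J ⊆ (Ioc 1 (Y + 1)).biUnion fun d =>
      {j ∈ range J | d.Coprime p ∧ d ^ 2 ∣ g + p * j} := by
    intro j hj
    have h := hnsq j hj
    rw [Nat.squarefree_iff_prime_squarefree] at h
    push Not at h
    obtain ⟨d, hd, hdvd⟩ := h
    rw [← sq] at hdvd
    have hcop : (g + p * j).Coprime p := by
      rwa [mul_comm, Nat.coprime_add_mul_right_left]
    have hpos : 0 < g + p * j := by
      rcases Nat.eq_zero_or_pos (g + p * j) with h0 | h0
      · rw [h0, Nat.coprime_zero_left] at hcop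
        exact absurd hcop hp.one_lt.ne'
      · exact h0
    simp only [mem_biUnion, mem_Ioc, mem_filter]
    refine ⟨d, ⟨hd.one_lt, ?_⟩, hj, Nat.Coprime.coprime_dvd_left
      ((dvd_pow_self d two_ne_zero).trans hdvd) hcop, hdvd⟩
    rw [← hY]
    refine Nat.le_floor (Real.le_sqrt_of_sq_le ?_)
    have h1 : ((d ^ 2 : ℕ) : ℝ) ≤ (g + p * j : ℕ) := by
      exact_mod_cast Nat.le_of_dvd hpos hdvd
    push_cast at h1
    have h2 := hlt j hj
    push_cast at h2
    linarith
  have hcard := (card_le_card hcover).trans card_biUnion_le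
  rw [card_range] at hcard
  have hterm : ∀ d ∈ Ioc 1 (Y + 1), ((#{j ∈ range J | d.Coprime p ∧ d ^ 2 ∣ g + p * j} : ℕ) : ℝ)
      ≤ J * (1 / (d : ℝ) ^ 2) + 1 := by
    intro d hd
    have hd1 := (mem_Ioc.mp hd).1
    by_cases hcop : d.Coprime p
    · rw [filter_congr (fun j _ => and_iff_right hcop)]
      have h1 := card_filter_dvd_add_mul_le (p := p) (d := d ^ 2)
        (Nat.Coprime.pow_left 2 hcop) g J
      have h2 := Nat.cast_div_le (α := ℝ) (m := J) (n := d ^ 2)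
      push_cast at h2
      rw [mul_one_div]
      have h3 : ((#{j ∈ range J | d ^ 2 ∣ g + p * j} : ℕ) : ℝ) ≤ ((J / d ^ 2 : ℕ) : ℝ) + 1 := by
        exact_mod_cast h1
      linarith
    · rw [filter_false_of_mem (fun j _ h => hcop h.1), card_empty, Nat.cast_zero]
      positivity
  have h1 : (J : ℝ) ≤ J * (2 / 3) + Y := by
    have h2 : (J : ℝ) ≤ ∑ d ∈ Ioc 1 (Y + 1), (J * (1 / (d : ℝ) ^ 2) + 1) := by
      refine le_trans ?_ (sum_le_sum hterm)
      exact_mod_cast hcard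
    rw [sum_add_distrib, ← mul_sum, sum_const, Nat.card_Ioc, nsmul_eq_mul, mul_one,
      Nat.add_sub_cancel] at h2
    refine h2.trans ?_
    gcongr
    have := sum_one_div_sq_le Y
    have : (0 : ℝ) ≤ 1 / ((Y : ℝ) + 3 / 2) := by positivity
    linarith
  have h3 : 3.3 * √x ≤ x / p := by
    rw [le_div_iff₀ (by positivity)]
    nlinarith [Real.sqrt_nonneg x]
  push_cast at hYle
  linarith

lemma exists_squarefree_isPrimRootMod_of_large {p : ℕ} (hp : p.Prime) {x : ℝ} (hx : 0 < x)
    (hpx : 3.3 * p ≤ √x) : ∃ g : ℕ, Squarefree g ∧ IsPrimRootMod g p ∧ (g : ℝ) < x := by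
  have := Fact.mk hp
  obtain ⟨g, hg⟩ := IsCyclic.exists_generator (α := (ZMod p)ˣ)
  have hcast : (((g : ZMod p).val : ℕ) : ZMod p) = g := ZMod.natCast_zmod_val _
  have hcop : ((g : ZMod p).val).Coprime p := ZMod.val_coe_unit_coprime g
  obtain ⟨n, hsq, hn, hlt⟩ := exists_squarefree_modEq hp hcop (ZMod.val_lt _) hx hpx
  refine ⟨n, hsq, ⟨?_, ?_⟩, hlt⟩
  · rw [← ZMod.isUnit_iff_coprime, hn, hcast]
    exact g.isUnit
  · rw [hn, hcast, orderOf_units, orderOf_eq_card_of_forall_mem_zpowers hg,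
      Nat.card_eq_fintype_card, ZMod.card_units, Nat.totient_prime hp]

lemma pos_of_one_lt_splitD {p : ℕ} (hp : 1 < p) {x : ℝ} (hD : 1 < splitD p x) : 0 < x := by
  by_contra! hx
  have hL : 0 < Real.log p := Real.log_pos (by exact_mod_cast hp)
  have hc : 0 < pvConst p := by rw [pvConst]; positivity
  rw [splitD, ← Real.sqrt_eq_rpow, Real.sqrt_eq_zero_of_nonpos
    (div_nonpos_of_nonpos_of_nonneg hx (by positivity))] at hD
  linarith

lemma one_le_of_one_lt_splitD {p : ℕ} (hp : 1 < p) {x : ℝ} (hD : 1 < splitD p x) : 1 ≤ x := by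
  have hp1 : (1 : ℝ) ≤ √(p : ℝ) := Real.one_le_sqrt.mpr (by exact_mod_cast hp.le)
  have hK2 := two_mul_le_pvConst_mul hp
  by_contra! hx
  rw [splitD, ← Real.sqrt_eq_rpow] at hD
  refine absurd hD (not_lt.mpr (Real.sqrt_le_one.mpr (div_le_one_of_le₀ ?_ ?_))) <;> linarith

/-- A lower bound for `charErr`, used to absorb the secondary terms. -/
lemma charErr_ge {p : ℕ} (hp : 3 ≤ p) {x : ℝ} (hx : 0 < x) (hD : 1 < splitD p x) :
    3.877 * √x + 1 ≤ 2 * charErr p x := by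
  have hp1 : 1 < p := by omega
  have hp3 : (3 : ℝ) ≤ p := by exact_mod_cast hp
  have hKe := pvConst_mul hp1
  have hK2 := two_mul_le_pvConst_mul hp1
  have hU := one_div_pi_mul_sqrt_two_ge
  -- From `2³ ≤ 3²`, `log 3 ≥ (3/2) log 2`; the numerical bounds on `κ` below are those for `p = 3`.
  have hlog3 : 1.039 ≤ Real.log p := by
    have h1 : Real.log 3 ≤ Real.log p := Real.log_le_log (by norm_num) hp3
    have h2 : Real.log 8 ≤ Real.log 9 := Real.log_le_log (by norm_num) (by norm_num)
    rw [show (8 : ℝ) = 2 ^ 3 by norm_num, show (9 : ℝ) = 3 ^ 2 by norm_num, Real.log_pow,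
      Real.log_pow] at h2
    push_cast at h2
    linarith [Real.log_two_gt_d9]
  have hsq3 : 1.732 ≤ √(p : ℝ) := Real.le_sqrt_of_sq_le (by norm_num; linarith)
  obtain ⟨u, v, γ, w, hu, hv, hγ, hw, hpu, hLv, hcγ, hxw, hsq, hDe, hE, hx2, -, hp4⟩ :=
    exists_roots hp1 hx
  have hu0 : 0 < u := by linarith
  set κ := γ * u * v with hκ
  have hκ0 : 0 < κ := by positivity
  have hKκ : pvConst p * √p * Real.log p = κ ^ 4 := by rw [hcγ, hsq, hLv, hκ]; ring
  have hsx : √x = w ^ 2 := by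
    rw [hxw, show w ^ 4 = (w ^ 2) ^ 2 by ring, Real.sqrt_sq (by positivity)]
  have hκ4 : 4.475 ≤ κ ^ 4 := by
    rw [← hKκ, hKe, div_eq_mul_one_div (_ + 6)]
    have h1 : 7.039 * 0.225 + 1 ≤ (Real.log p + 6) * (1 / (Real.pi * √2)) + 1 := by
      gcongr
      linarith
    calc (4.475 : ℝ) ≤ 1.732 * (7.039 * 0.225 + 1) := by norm_num
      _ ≤ _ := by gcongr
  have hκ2 : 2.1154 ≤ κ ^ 2 := by nlinarith [sq_nonneg κ]
  have hDhat : 1 + κ ^ 2 / w ^ 2 ≤ splitDHat p x := by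
    have := splitD_lt_splitDHat_bound hD
    rw [splitDHat]
    refine le_trans (le_of_eq ?_) this
    rw [hDe, one_div_div]
  have hLu : v ^ 4 ≤ 8 * (u ^ 3 - 1) / 3 := by
    have h1 := Real.log_le_sub_one_of_pos (show 0 < u ^ 3 by positivity)
    rw [Real.log_pow] at h1
    rw [← hLv, hpu, Real.log_pow]
    push_cast at h1 ⊢
    linarith
  have hκu : u ≤ κ := by
    rw [hKκ, hsq] at hK2
    refine le_of_pow_le_pow_left₀ (n := 4) (by norm_num) hκ0.le ?_
    have : 0 < u ^ 4 := by positivity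
    linarith
  have hκu3 : u ^ 3 ≤ κ ^ 3 := by gcongr
  rw [charErr, hE, hx2, hp4, hsx]
  have ha := six_div_pi_sq_mem.1
  set a := 6 / Real.pi ^ 2
  have hA0 : 0 < cipuConst := by rw [cipuConst]; norm_num
  set A := cipuConst
  have e1 : v ^ 2 * (a * (γ ^ 2 + splitDHat p x * γ ^ 2 - 1 / (u ^ 2 * v ^ 2))
        + A * (u * γ ^ 3 * v / w - 1 / 3 * (v ^ 2 / (u ^ 2 * w))
          + 7 / 3 * (u * v * γ ^ 3 / w))) * w ^ 2 * u ^ 2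
      = a * (w ^ 2 * κ ^ 2 * (1 + splitDHat p x) - w ^ 2)
        + A * w * (10 / 3 * κ ^ 3 - 1 / 3 * v ^ 4) := by
    rw [hκ]; field_simp; ring
  have h1 : 0 ≤ A * w * (10 / 3 * κ ^ 3 - 1 / 3 * v ^ 4) := by
    have : 0 < u ^ 3 := by positivity
    exact mul_nonneg (by positivity) (by linarith)
  have h2 : a * (w ^ 2 * κ ^ 2 * (1 + (1 + κ ^ 2 / w ^ 2)) - w ^ 2)
      ≤ a * (w ^ 2 * κ ^ 2 * (1 + splitDHat p x) - w ^ 2) := by gcongr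
  have e4 : a * (w ^ 2 * κ ^ 2 * (1 + (1 + κ ^ 2 / w ^ 2)) - w ^ 2)
      = a * ((2 * κ ^ 2 - 1) * w ^ 2 + κ ^ 4) := by field_simp; ring
  have h3 : 0.6079271 * ((2 * 2.1154 - 1) * w ^ 2 + 4.475)
      ≤ a * ((2 * κ ^ 2 - 1) * w ^ 2 + κ ^ 4) := by gcongr
  rw [e1]
  have : 0 < w ^ 2 := by positivity
  linarith

/-- The square-free integers in `[1, N]` prime to `p`. -/
def sqfreeCoprime (p N : ℕ) : Finset ℕ := {n ∈ Ioc 0 N | Squarefree n ∧ n.Coprime p}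

lemma sqfreeCount_le_card_sqfreeCoprime {p : ℕ} (hp : p.Prime) (N : ℕ) :
    sqfreeCount N ≤ #(sqfreeCoprime p N) + N / p := by
  have h1 : #{n ∈ Ioc 0 N | p ∣ n} = N / p := Nat.Ioc_filter_dvd_card_eq_div N p
  rw [← h1]
  refine (card_le_card ?_).trans (card_union_le _ _)
  intro n hn
  rw [mem_filter] at hn
  rw [mem_union, sqfreeCoprime, mem_filter, mem_filter]
  by_cases hd : p ∣ n
  · exact Or.inr ⟨hn.1, hd⟩
  · exact Or.inl ⟨hn.1, hn.2, ((Nat.Prime.coprime_iff_not_dvd hp).mpr hd).symm⟩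

lemma sum_sqfreeCoprime_mulChar (p N : ℕ) (χ : MulChar (ZMod p) ℂ) :
    ∑ n ∈ sqfreeCoprime p N, χ (n : ZMod p)
      = ∑ n ∈ Ioc 0 N, if Squarefree n then χ (n : ZMod p) else 0 := by
  rw [sqfreeCoprime, ← filter_filter, ← sum_filter, sum_filter_of_ne]
  intro n _ hne
  by_contra hcop
  exact hne (MulChar.map_nonunit χ (fun hu => hcop ((ZMod.isUnit_iff_coprime n p).mp hu)))

lemma card_sqfreeCoprime_ge {p : ℕ} (hp : p.Prime) {x : ℝ} (hx : 1 ≤ x) {N : ℕ}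
    (hN : (N : ℝ) < x) (hN' : x ≤ N + 1) :
    6 / Real.pi ^ 2 * x - cipuConst * √x - 1 - x / p ≤ #(sqfreeCoprime p N) := by
  have hp0 : (0 : ℝ) < p := by exact_mod_cast hp.pos
  have h1 := (abs_le.mp (abs_sqfreeCount_sub_le hx)).1
  -- When `x` is an integer, `N = x - 1` and one square-free number may be lost.
  have h2 : sqfreeCount ⌊x⌋₊ ≤ sqfreeCount N + 1 := by
    have h3 : ⌊x⌋₊ ≤ N + 1 := by
      have : ((⌊x⌋₊ : ℕ) : ℝ) ≤ ((N + 1 : ℕ) : ℝ) := by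
        push_cast; exact (Nat.floor_le (by linarith)).trans hN'
      exact_mod_cast this
    calc sqfreeCount ⌊x⌋₊ ≤ sqfreeCount (N + 1) := by
          refine card_le_card (filter_subset_filter _ (Ioc_subset_Ioc_right h3))
      _ ≤ _ := by rw [sqfreeCount_succ]; split_ifs <;> omega
  have h4 := sqfreeCount_le_card_sqfreeCoprime hp N
  have h5 : (sqfreeCount ⌊x⌋₊ : ℝ) ≤ #(sqfreeCoprime p N) + ((N / p : ℕ) : ℝ) + 1 := by
    exact_mod_cast (by omega : sqfreeCount ⌊x⌋₊ ≤ #(sqfreeCoprime p N) + N / p + 1)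
  have h6 : ((N / p : ℕ) : ℝ) ≤ x / p := by
    refine Nat.cast_div_le.trans ?_
    gcongr
  linarith

/-- The sieve hypothesis, in terms of the number of available square-free integers. -/
lemma main_term_of_sieveG_pos {p k s : ℕ} (hp : 1 < p) {q : Fin s → ℕ} {x : ℝ} (hx : 0 < x)
    (hG : 0 < sieveG p k q x) :
    0.104 * √x + (2 ^ ArithmeticFunction.cardDistinctFactors k * sieveBigDelta q + 1) * charErr p x
      < 6 / Real.pi ^ 2 * x := by
  obtain ⟨u, v, γ, w, hu, hv, hγ, hw, hpu, hLv, hcγ, hxw, hsq, hDe, -, hx2, hpm, hp4⟩ :=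
    exists_roots hp hx
  have hu0 : 0 < u := by linarith
  have hsx : √x = w ^ 2 := by
    rw [hxw, show w ^ 4 = (w ^ 2) ^ 2 by ring, Real.sqrt_sq (by positivity)]
  rw [sieveG, hx2, hpm, hp4] at hG
  rw [charErr, hx2, hp4, hsx]
  generalize (2 : ℝ) ^ ArithmeticFunction.cardDistinctFactors k * sieveBigDelta q + 1 = M at *
  generalize errE p x = E at *
  have h1 := mul_pos hG (show 0 < 6 / Real.pi ^ 2 * (w ^ 2 * u ^ 2) by positivity)
  have e : (w ^ 2 * (1 / u ^ 2) - Real.pi ^ 2 / 6 * (0.104 / u ^ 2 + M * E))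
        * (6 / Real.pi ^ 2 * (w ^ 2 * u ^ 2))
      = 6 / Real.pi ^ 2 * w ^ 4 - (0.104 * w ^ 2 + M * (E * w ^ 2 * u ^ 2)) := by
    have := Real.pi_ne_zero
    field_simp
  rw [e] at h1
  rw [hxw]
  linarith

end SquarefreePrimitiveRoot

/-! ### Assembly -/

namespace SquarefreePrimitiveRoot
open Finset

theorem exists_squarefree_isPrimRootMod {p : ℕ} (hp : p.Prime) {k s : ℕ} {q : Fin s → ℕ}
    (hq : IsSieving p k q) (hδ : 0 < sieveDelta q) {x : ℝ} (hD : 1 < splitD p x)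
    (hG : 0 < sieveG p k q x) :
    ∃ g : ℕ, Squarefree g ∧ IsPrimRootMod g p ∧ (g : ℝ) < x := by
  have := Fact.mk hp
  obtain ⟨hs, hqp, -, hrad, hcore⟩ := hq
  have hp10 : p - 1 ≠ 0 := by have := hp.two_le; omega
  have hdvd : k * ∏ i, q i ∣ p - 1 := hrad ▸ UniqueFactorizationMonoid.radical_dvd_self
  have hqdvd (i : Fin s) : q i ∣ p - 1 :=
    ((dvd_prod_of_mem q (mem_univ i)).mul_left k).trans hdvd
  have hk0 : k ≠ 0 := by
    rintro rfl
    rw [zero_mul, zero_dvd_iff] at hdvd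
    exact hp10 hdvd
  have hp3 : 3 ≤ p := by
    have h1 := Nat.le_of_dvd (by omega) (hqdvd ⟨0, hs⟩)
    have h2 := (hqp ⟨0, hs⟩).two_le
    omega
  have hx : 0 < x := pos_of_one_lt_splitD hp.one_lt hD
  -- Beyond this size the multiples of `p` are too numerous to be absorbed, but no sieve is needed.
  by_cases hlarge : 3.3 * p ≤ √x
  · exact exists_squarefree_isPrimRootMod_of_large hp hx hlarge
  push Not at hlarge
  have hF := charErr_ge hp3 hx hD
  have hmain := main_term_of_sieveG_pos hp.one_lt hx hG
  have hx1 : 1 ≤ x := one_le_of_one_lt_splitD hp.one_lt hD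
  -- `N` is the largest integer strictly below `x`.
  obtain ⟨N, hN⟩ : ∃ N, ⌈x⌉₊ = N + 1 :=
    Nat.exists_eq_succ_of_ne_zero (Nat.ceil_pos.mpr hx).ne'
  have hNlt : (N : ℝ) < x := Nat.lt_ceil.mp (by omega)
  have hNge : x ≤ N + 1 := by
    have := Nat.le_ceil x
    rw [hN] at this
    exact_mod_cast this
  have hcard := card_sqfreeCoprime_ge hp hx1 hNlt hNge
  have hxp : x / p ≤ 3.3 * √x := by
    have hp0 : (0 : ℝ) < p := by exact_mod_cast hp.pos
    rw [div_le_iff₀ hp0]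
    nlinarith [Real.mul_self_sqrt hx.le, Real.sqrt_nonneg x]
  have hex : ∀ r : ℕ, ∃ χ : MulChar (ZMod p) ℂ, r.Prime → r ∣ p - 1 → orderOf χ = r := by
    intro r
    by_cases h : r.Prime ∧ r ∣ p - 1
    · obtain ⟨χ, hχ⟩ := exists_mulChar_orderOf_eq h.1.ne_zero h.2
      exact ⟨χ, fun _ _ => hχ⟩
    · exact ⟨1, fun h1 h2 => absurd ⟨h1, h2⟩ h⟩
  choose χ hχ using hex
  have hkdvd : ∀ r ∈ k.primeFactors, r ∣ p - 1 := fun r hr =>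
    ((Nat.dvd_of_mem_primeFactors hr).mul_right _).trans hdvd
  have hω : ArithmeticFunction.cardDistinctFactors k = #k.primeFactors := by
    rw [ArithmeticFunction.cardDistinctFactors_apply]; rfl
  obtain ⟨n, hn, hnk, hnq⟩ := exists_apply_ne_one (S := sqfreeCoprime p N)
    (fun n hn => (mem_filter.mp hn).2.2) (err := charErr p x)
    (fun ψ hψ => by
      rw [sum_sqfreeCoprime_mulChar]
      exact norm_sum_squarefree_mulChar_le_charErr hψ hx hD hNlt.le)
    χ k.primeFactors
    (fun r hr => ⟨Nat.prime_of_mem_primeFactors hr,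
      hχ r (Nat.prime_of_mem_primeFactors hr) (hkdvd r hr)⟩)
    q (fun i => ⟨hqp i, hχ _ (hqp i) (hqdvd i)⟩)
    (fun i hi => lt_irrefl _ (hcore _ hi i)) hδ
    (by
      rw [← hω]
      refine lt_of_lt_of_le ?_ hcard
      rw [add_one_mul] at hmain
      rw [cipuConst, mul_comm, sub_one_mul]
      -- The coefficients of `√x` balance: `3.3 + 0.679091 ≤ 3.877 + 0.104`.
      linarith [Real.sqrt_nonneg x])
  obtain ⟨hnI, hnsq, hncop⟩ := mem_filter.mp hn
  refine ⟨n, hnsq, isPrimRootMod_of_apply_ne_one χ hχ hncop ?_,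
    lt_of_le_of_lt (by exact_mod_cast (mem_Ioc.mp hnI).2) hNlt⟩
  intro r hr hrp
  have h1 : r ∣ k * ∏ i, q i := by
    rw [← hrad]
    exact (UniqueFactorizationMonoid.dvd_radical_iff_of_irreducible hr hp10).mpr hrp
  rcases hr.dvd_mul.mp h1 with h | h
  · exact hnk r (Nat.mem_primeFactors.mpr ⟨hr, h, hk0⟩)
  · obtain ⟨i, -, hi⟩ := (Prime.dvd_finsetProd_iff hr.prime q).mp h
    rw [(Nat.prime_dvd_prime_iff_eq hr (hqp i)).mp hi]
    exact hnq i

end SquarefreePrimitiveRoot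

theorem mainTheorem3 (p : ℕ) (hp : p.Prime) (k s : ℕ) (q : Fin s → ℕ)
    (hq : SquarefreePrimitiveRoot.IsSieving p k q)
    (hδ : 0 < SquarefreePrimitiveRoot.sieveDelta q)
    (x : ℝ) (hD : 1 < SquarefreePrimitiveRoot.splitD p x)
    (hG : 0 < SquarefreePrimitiveRoot.sieveG p k q x) :
    ∃ g : ℕ, Squarefree g ∧ SquarefreePrimitiveRoot.IsPrimRootMod g p ∧ (g : ℝ) < x :=
  SquarefreePrimitiveRoot.exists_squarefree_isPrimRootMod hp hq hδ hD hG
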